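/- Let $d\ge 1$, $\alpha\in(0,2]$ and $\mathfrak c>0$. Let $\mu$ be a symmetric probability law on $\mathbb R$ in the domain of normal attraction of the symmetric $\alpha$-stable law of scale $\mathfrak c$: if $W_1,W_2,\dots$ are i.i.d. with law $\mu$, then $N^{-1/\alpha}(W_1+\dots+W_N)$ converges in distribution, as $N\to\infty$, to a random variable $\rho_\alpha$ with $\mathbb E[e^{i\theta\rho_\alpha}]=e^{-\mathfrak c^\alpha|\theta|^\alpha}$ for all $\theta\in\mathbb R$. For $n\ge1$ let $\mathbb Z_n^d$ be the discrete torus $(\mathbb Z/n\mathbb Z)^d$ (with $n^d$ sites), let $(\sigma(x))_{x\in\mathbb Z_n^d}$ be i.i.d. with law $\mu$, and consider the divisible sandpile started from $$s(x)=1+\sigma(x)-\frac1{n^d}\sum_{z\in\mathbb Z_n^d}\sigma(z).$$ At each time step, every site $x$ whose current mass $s_t(x)$ exceeds $1$ keeps mass $1$ and distributes its excess $(s_t(x)-1)^+$ equally among its $2d$ nearest neighbours. Let $u_n(x)$ be the odometer, that is, the total mass that $x$ sends to each one of its $2d$ neighbours during stabilisation, $u_n(x)=\frac1{2d}\sum_{t\ge0}(s_t(x)-1)^+$;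 it is finite. Let $\mathbb T^d=\mathbb R^d/\mathbb Z^d$ and let $\mathbb T_n^d$ be the set of its $n^d$ points whose coordinates are multiples of $1/n$. Put $$\Xi_n(x)=\sum_{z\in\mathbb T_n^d}u_n(nz)\,\mathbf 1_{B(z,1/(2n))}(x)\quad(x\in\mathbb T^d),\qquad a_n=4\pi^2n^{d-d/\alpha-2},$$ where $B(z,r)$ is the ball of radius $r$ about $z$ for the $\ell^\infty$-distance, and $\langle \Xi_n,f\rangle=\int_{\mathbb T^d}\Xi_n(x)f(x)\,dx$. Then there is a random distribution $\Xi_\alpha$, with values in the dual $(C^\infty(\mathbb T^d))^*$ of the real smooth functions, such that for all $m$ and all $f_1,\dots,f_m\in C^\infty(\mathbb T^d)$ with mean zero, the random vectors $(\langle a_n\Xi_n,f_j\rangle)_{j\le m}$ converge in distribution to $(\langle\Xi_\alpha,f_j\rangle)_{j\le m}$ as $n\to\infty$. The characteristic functional of $\Xi_\alpha$ is, for every $f\in C^\infty(\mathbb T^d)$, $$\mathbb E\big[e^{i\langle\Xi_\alpha,f\rangle}\big]=\exp\left(-\mathfrak c^{\alpha}\int_{\mathbb T^d}\left|\sum_{z\in\mathbb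 Z^d\setminus\{0\}}\frac{e^{-2\pi i z\cdot x}}{\|z\|^2}\,\widehat f(z)\right|^\alpha dx\right),\qquad \widehat f(z)=\int_{\mathbb T^d}f(y)e^{-2\pi i z\cdot y}\,dy,$$ where $\|z\|$ is the Euclidean norm, the series converges absolutely for each $x$ and the integral is finite. Moreover $\Xi_\alpha$ is $\alpha$-stable: if $\Xi_{\alpha,1},\Xi_{\alpha,2}$ are independent copies of $\Xi_\alpha$, then for all $a,b>0$ and $f\in C^\infty(\mathbb T^d)$, $$\mathbb E\big[e^{i\langle\Xi_{\alpha,1},af\rangle}\big]\,\mathbb E\big[e^{i\langle\Xi_{\alpha,2},bf\rangle}\big]=\mathbb E\big[e^{i\langle\Xi_\alpha,(a^\alpha+b^\alpha)^{1/\alpha}f\rangle}\big].$$ -/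

import Mathlib

open MeasureTheory ProbabilityTheory Filter Topology
open scoped ENNReal

noncomputable section

namespace Sandpile

/-! ### Smooth functions and random distributions on the torus `𝕋ᵈ = ℝᵈ / ℤᵈ` -/

/-- The `ℤᵈ`-periodic function on `ℝᵈ` associated with a function on the torus. -/
def lift {d : ℕ} (f : UnitAddTorus (Fin d) → ℝ) (v : Fin d → ℝ) : ℝ :=
  f (fun i => (v i : UnitAddCircle))

/-- `C^∞(𝕋ᵈ)`: the real vector space of functions on the torus whose periodic lift is smooth. -/
def SmoothFun (d : ℕ) : Submodule ℝ (UnitAddTorus (Fin d) → ℝ) where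
  carrier := {f | ContDiff ℝ ((⊤ : ℕ∞) : WithTop ℕ∞) (lift f)}
  add_mem' := by
    intro f g hf hg
    have hf' : ContDiff ℝ ((⊤ : ℕ∞) : WithTop ℕ∞) (lift f) := hf
    have hg' : ContDiff ℝ ((⊤ : ℕ∞) : WithTop ℕ∞) (lift g) := hg
    exact hf'.add hg'
  zero_mem' := by
    have h : ContDiff ℝ ((⊤ : ℕ∞) : WithTop ℕ∞) (fun _ : Fin d → ℝ => (0 : ℝ)) := contDiff_const
    exact h
  smul_mem' := by
    intro c f hf
    have hf' : ContDiff ℝ ((⊤ : ℕ∞) : WithTop ℕ∞) (lift f) := hf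
    exact hf'.const_smul c

/-- `(C^∞(𝕋ᵈ))^*`: the distributions on the torus, that is the linear functionals `L` on
`C^∞(𝕋ᵈ)` that are continuous for the Fréchet topology of uniform convergence of all derivatives:
`|L f| ≤ C · max_{j ≤ k} sup_v ‖D^j f(v)‖` for some `k` and `C` (the maximum on the right is
expressed through its upper bounds `B`). -/
def TorusDistribution (d : ℕ) : Type :=
  {L : SmoothFun d →ₗ[ℝ] ℝ // ∃ (k : ℕ) (C : ℝ), ∀ (f : SmoothFun d) (B : ℝ),
    (∀ j ≤ k, ∀ v : Fin d → ℝ, ‖iteratedFDeriv ℝ j (lift f.1) v‖ ≤ B) → |L f| ≤ C * B}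

/-- The pairing `⟨Ξ, f⟩` of a distribution and a test function. -/
def TorusDistribution.pair {d : ℕ} (T : TorusDistribution d) (f : SmoothFun d) : ℝ := T.1 f

/-- The cylinder `σ`-algebra, generated by the evaluations `Ξ ↦ ⟨Ξ, f⟩`. -/
instance TorusDistribution.instMeasurableSpace (d : ℕ) : MeasurableSpace (TorusDistribution d) :=
  ⨆ f : SmoothFun d, MeasurableSpace.comap (fun T => T.pair f) inferInstance

/-- The characteristic functional `f ↦ 𝔼[exp(i ⟨Ξ, f⟩)]` of a random distribution `Ξ` of law `Q`. -/
def charFunctional {d : ℕ} (Q : Measure (TorusDistribution d)) (f : SmoothFun d) : ℂ :=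
  ∫ T, Complex.exp (Complex.I * (T.pair f : ℂ)) ∂Q

/-- A random distribution `Ξ` of law `Q` is `α`-stable: for independent copies `Ξ₁`, `Ξ₂` of `Ξ`,
`𝔼[exp(i⟨Ξ₁, a f⟩)] 𝔼[exp(i⟨Ξ₂, b f⟩)] = 𝔼[exp(i⟨Ξ, (a^α + b^α)^{1/α} f⟩)]` for all `a, b > 0`. -/
def IsAlphaStableField {d : ℕ} (α : ℝ) (Q : Measure (TorusDistribution d)) : Prop :=
  ∀ (a b : ℝ), 0 < a → 0 < b → ∀ f : SmoothFun d,
    charFunctional Q (a • f) * charFunctional Q (b • f) =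
      charFunctional Q (((a ^ α + b ^ α) ^ (1 / α)) • f)

/-- The summand `e^{-2π i z·x} f̂(z) / ‖z‖²` for a nonzero frequency `z ∈ ℤᵈ`, where
`f̂(z) = ∫ f(y) e^{-2π i z·y} dy` and `‖·‖` is the Euclidean norm. -/
def fourierTerm {d : ℕ} (f : SmoothFun d) (x : UnitAddTorus (Fin d))
    (z : {z : Fin d → ℤ // z ≠ 0}) : ℂ :=
  UnitAddTorus.mFourier (-z.1) x * UnitAddTorus.mFourierCoeff (fun y => (f.1 y : ℂ)) z.1 /
    ((∑ i, (z.1 i : ℝ) ^ 2 : ℝ) : ℂ)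

/-! ### Stable laws and their domain of normal attraction -/

/-- `ρ` is the symmetric `α`-stable law with scale `c`: `𝔼[exp(iθρ)] = exp(-c^α |θ|^α)`. -/
def IsSymmStable (α c : ℝ) (ρ : Measure ℝ) : Prop :=
  ∀ θ : ℝ, charFun ρ θ = (Real.exp (-(c ^ α * |θ| ^ α)) : ℂ)

/-- The law `μ` is symmetric and lies in the domain of normal attraction of the symmetric
`α`-stable law with scale `c`: if `W₁, W₂, …` are i.i.d. of law `μ`, then
`N^{-1/α} (W₁ + ⋯ + W_N)` converges in distribution to that stable law as `N → ∞`. -/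
def InDomainOfNormalAttraction (α c : ℝ) (μ : Measure ℝ) [IsProbabilityMeasure μ] : Prop :=
  μ.map (fun w => -w) = μ ∧
  ∃ (ρ : Measure ℝ) (_ : IsProbabilityMeasure ρ), IsSymmStable α c ρ ∧
    TendstoInDistribution
      (fun (N : ℕ) (w : Fin N → ℝ) => (N : ℝ) ^ (-(1 / α)) * ∑ i, w i)
      atTop (id : ℝ → ℝ) (fun N => Measure.pi (fun _ : Fin N => μ)) ρ

/-! ### The divisible sandpile on the discrete torus `ℤ_n^d` -/

/-- The sites of the discrete torus with side length `n`. -/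
abbrev Site (d : ℕ) (n : ℕ+) : Type := Fin d → ZMod n

/-- The generator of nearest-neighbour simple random walk,
`Δ f(x) = (1/2d) ∑_{y ∼ x} (f(y) - f(x))`. -/
def laplacian {d : ℕ} {n : ℕ+} (f : Site d n → ℝ) (x : Site d n) : ℝ :=
  (1 / (2 * (d : ℝ))) *
    ∑ i : Fin d, ((f (x + Pi.single i 1) - f x) + (f (x - Pi.single i 1) - f x))

/-- The excess `(s(x) - 1)^+` emitted from `x` in one parallel toppling of `s`. -/
def excess {d : ℕ} {n : ℕ+} (s : Site d n → ℝ) (x : Site d n) : ℝ := max (s x - 1) 0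

/-- One parallel toppling: every unstable site keeps mass `1` and distributes its excess equally
among its `2d` nearest neighbours. -/
def topple {d : ℕ} {n : ℕ+} (s : Site d n → ℝ) (x : Site d n) : ℝ :=
  s x + laplacian (excess s) x

/-- The total mass `∑_{i < t} (s_i(x) - 1)^+` emitted from `x` up to time `t`, where `s_i` is the
configuration after `i` parallel topplings of `s`. -/
def emittedUpTo {d : ℕ} {n : ℕ+} (s : Site d n → ℝ) (t : ℕ) (x : Site d n) : ℝ :=
  ∑ i ∈ Finset.range t, excess (topple^[i] s) x

/-- The total mass emitted from `x` during the whole stabilisation, a value in `[0, ∞]`. -/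
def emitted {d : ℕ} {n : ℕ+} (s : Site d n → ℝ) (x : Site d n) : ℝ≥0∞ :=
  ⨆ t : ℕ, ENNReal.ofReal (emittedUpTo s t x)

/-- The odometer: the total mass sent from `x` to each one of its `2d` nearest neighbours during
stabilisation. -/
def odometer {d : ℕ} {n : ℕ+} (s : Site d n → ℝ) (x : Site d n) : ℝ :=
  (emitted s x).toReal / (2 * d)

/-- The initial configuration `s(x) = 1 + σ(x) - n^{-d} ∑_z σ(z)`. -/
def initialConfig {d : ℕ} {n : ℕ+} (σ : Site d n → ℝ) (x : Site d n) : ℝ :=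
  1 + σ x - (1 / (n : ℝ) ^ d) * ∑ z, σ z

/-- The odometer field `Ξ_n(x) = ∑_{z ∈ 𝕋_n^d} u(nz) 1_{B(z, 1/(2n))}(x)` on the torus, with balls
for the `ℓ^∞` distance; the points `z` of `𝕋_n^d` are written as `z = y/n` with `y ∈ ℤ_n^d`. -/
def odometerField {d : ℕ} {n : ℕ+} (s : Site d n → ℝ) (x : UnitAddTorus (Fin d)) : ℝ :=
  ∑ y : Site d n,
    (Metric.ball (fun i => ZMod.toAddCircle (y i)) (1 / (2 * (n : ℝ)))).indicator
      (fun _ => odometer s y) x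

/-- The pairing `⟨Ξ_n, f⟩ = ∫ Ξ_n(x) f(x) dx`. -/
def fieldPair {d : ℕ} {n : ℕ+} (s : Site d n → ℝ) (f : SmoothFun d) : ℝ :=
  ∫ x, odometerField s x * f.1 x

/-- The scaling `a_n = 4π² n^{d - d/α - 2}`. -/
def scaling (d : ℕ) (α : ℝ) (n : ℕ+) : ℝ :=
  4 * Real.pi ^ 2 * (n : ℝ) ^ ((d : ℝ) - (d : ℝ) / α - 2)

end Sandpile

end

noncomputable section

namespace Sandpile

/-! ### The discrete Laplacian on the torus -/

section Discrete

variable {d : ℕ} {n : ℕ+}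

/-! The initial mass is `1` per site on average, so stabilisation ends at the constant configuration
`1`, and the odometer `u` solves `2d Δu = 1 - s` exactly (`laplacian_odometer`). For a mean-zero
test function `f`, let `H` be the mean-zero solution of `2d n² ΔH = -4π² · (cell averages of f)`.
Summation by parts turns `a_n ⟨Ξ_n, f⟩` into the linear form `∑ n^{-d/α} H(x) σ(x)` in the i.i.d.
field (`scaling_mul_fieldPair`), so only a weighted sum of independent variables remains.

Limit of the weights: the function with Fourier coefficients `f̂(z)/‖z‖²` solves the discrete
Poisson equation up to a uniformly small error, since the symbol of `n²Δ` converges frequency by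
frequency and `f̂` is summable. The Poincaré inequality `l2_le_laplacian` then makes `H` close to it
in normalised `ℓ²`. As `α ≤ 2`, this is enough for `∑ |k_n|^α` to converge to `∫ |potential f|^α`
and for the weights `k_n = n^{-d/α} H` to tend to `0` uniformly (`exists_weights`).

Limit of the law: normal attraction gives `-log E[e^{itσ}] ~ c^α |t|^α` at `0`
(`tendsto_charExponent_div`), so the product of the characteristic functions tends to `exp(-c^α ∫
|potential f|^α)` (`tendsto_prod_charFun`). Linear combinations of test functions and Lévy's theorem
give joint convergence.

The limit field has to be constructed. Stable noise on the lattice points gives random Fourier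
coefficients whose laws are tight on sets of polynomial growth; a weak limit point has the right
characteristic functional (`exists_stable_law`). Coefficients of polynomial growth, divided by
`‖z‖²`, define a distribution, which is transported to `Q` in `exists_stable_distribution`. -/

lemma laplacian_add (f g : Site d n → ℝ) : laplacian (f + g) = laplacian f + laplacian g := by
  funext x
  simp only [laplacian, Pi.add_apply, ← mul_add, ← Finset.sum_add_distrib]
  congr 1
  exact Finset.sum_congr rfl fun i _ => by ring

lemma laplacian_smul (c : ℝ) (f : Site d n → ℝ) : laplacian (c • f) = c • laplacian f := by
  funext x
  simp only [laplacian, Pi.smul_apply, smul_eq_mul, Finset.mul_sum]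
  exact Finset.sum_congr rfl fun i _ => by ring

/-- The discrete Laplacian as a linear map. -/
def laplacianLM (d : ℕ) (n : ℕ+) : (Site d n → ℝ) →ₗ[ℝ] (Site d n → ℝ) where
  toFun := laplacian
  map_add' := laplacian_add
  map_smul' := laplacian_smul

@[simp] lemma laplacianLM_apply (f : Site d n → ℝ) : laplacianLM d n f = laplacian f := rfl

lemma laplacian_sub (f g : Site d n → ℝ) : laplacian (f - g) = laplacian f - laplacian g :=
  map_sub (laplacianLM d n) f g

lemma laplacian_sub_const (f : Site d n → ℝ) (c : ℝ) :
    laplacian (fun x => f x - c) = laplacian f := by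
  funext x
  simp [laplacian]

lemma sum_translate (f : Site d n → ℝ) (v : Site d n) : ∑ x, f (x + v) = ∑ x, f x :=
  Equiv.sum_comp (Equiv.addRight v) f

/-- Summation by parts: translating the backward difference by one step merges it with the forward
one into a symmetric Dirichlet form. -/
lemma sum_mul_laplacian (f g : Site d n → ℝ) :
    ∑ x, f x * laplacian g x = -(1 / (2 * (d : ℝ))) * ∑ i : Fin d, ∑ x,
      (f (x + Pi.single i 1) - f x) * (g (x + Pi.single i 1) - g x) := by
  have key : ∀ i : Fin d, ∑ x, f x * ((g (x + Pi.single i 1) - g x) +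
      (g (x - Pi.single i 1) - g x)) = - ∑ x : Site d n,
      (f (x + Pi.single i 1) - f x) * (g (x + Pi.single i 1) - g x) := by
    intro i
    have h := sum_translate (fun x => f x * (g (x - Pi.single i 1) - g x)) (Pi.single i 1)
    simp only [add_sub_cancel_right] at h
    simp only [mul_add, Finset.sum_add_distrib, ← h]
    rw [← Finset.sum_add_distrib, ← Finset.sum_neg_distrib]
    exact Finset.sum_congr rfl fun x _ => by ring
  simp only [laplacian]
  calc _ = 1 / (2 * (d : ℝ)) * ∑ i : Fin d, ∑ x, f x * ((g (x + Pi.single i 1) - g x) +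
      (g (x - Pi.single i 1) - g x)) := by
        rw [Finset.sum_comm, Finset.mul_sum]
        refine Finset.sum_congr rfl fun x _ => ?_
        rw [← Finset.mul_sum]; ring
    _ = _ := by simp only [key, Finset.sum_neg_distrib]; ring

lemma sum_mul_laplacian_comm (f g : Site d n → ℝ) :
    ∑ x, f x * laplacian g x = ∑ x, laplacian f x * g x := by
  rw [sum_mul_laplacian f g]
  simp only [mul_comm (laplacian f _)]
  rw [sum_mul_laplacian g f]
  simp only [mul_comm]

lemma sum_laplacian (f : Site d n → ℝ) : ∑ x, laplacian f x = 0 := by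
  have := sum_mul_laplacian (fun _ => 1) f
  simpa using this

/-- The `ℓ²` norm of a function on the discrete torus. -/
def l2 (f : Site d n → ℝ) : ℝ := ‖WithLp.toLp 2 f‖

lemma l2_sq (f : Site d n → ℝ) : l2 f ^ 2 = ∑ x, f x ^ 2 := by
  simp [l2, EuclideanSpace.real_norm_sq_eq]

lemma l2_nonneg (f : Site d n → ℝ) : 0 ≤ l2 f := norm_nonneg _

lemma l2_add_le (f g : Site d n → ℝ) : l2 (f + g) ≤ l2 f + l2 g := by
  simpa [l2] using norm_add_le (WithLp.toLp 2 f) (WithLp.toLp 2 g)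

lemma l2_translate (f : Site d n → ℝ) (v : Site d n) : l2 (fun x => f (x + v)) = l2 f := by
  rw [← sq_eq_sq₀ (l2_nonneg _) (l2_nonneg _), l2_sq, l2_sq]
  exact sum_translate (fun x => f x ^ 2) v

/-- The difference of `f` along `v`. -/
def diff (v : Site d n) (f : Site d n → ℝ) (x : Site d n) : ℝ := f (x + v) - f x

lemma l2_diff_add_le (f : Site d n → ℝ) (v w : Site d n) :
    l2 (diff (v + w) f) ≤ l2 (diff v f) + l2 (diff w f) := by
  have : diff (v + w) f = (fun x => diff v f (x + w)) + diff w f := by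
    funext x
    simp only [diff, Pi.add_apply]
    rw [show x + (v + w) = x + w + v by abel]; ring
  rw [this]
  exact (l2_add_le _ _).trans (by rw [l2_translate])

lemma l2_diff_zero (f : Site d n → ℝ) : l2 (diff 0 f) = 0 := by
  have : diff 0 f = 0 := by funext x; simp [diff]
  simp [this, l2]

lemma l2_diff_nsmul_le (f : Site d n → ℝ) (v : Site d n) (k : ℕ) :
    l2 (diff (k • v) f) ≤ k * l2 (diff v f) := by
  induction k with
  | zero => simp [l2_diff_zero]
  | succ k ih =>
    rw [succ_nsmul]
    refine (l2_diff_add_le _ _ _).trans ?_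
    push_cast; linarith

lemma l2_diff_sum_le {ι : Type*} (s : Finset ι) (f : Site d n → ℝ) (v : ι → Site d n) :
    l2 (diff (∑ i ∈ s, v i) f) ≤ ∑ i ∈ s, l2 (diff (v i) f) := by
  classical
  induction s using Finset.induction_on with
  | empty => simp [l2_diff_zero]
  | insert a s ha ih =>
    rw [Finset.sum_insert ha, Finset.sum_insert ha]
    exact (l2_diff_add_le _ _ _).trans (by linarith)

/-- The displacement `v` is a path of fewer than `n` unit steps in each direction, and each step
contributes the same amount because `l2` is translation invariant. -/
lemma l2_diff_le (f : Site d n → ℝ) (v : Site d n) :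
    l2 (diff v f) ≤ n * ∑ i : Fin d, l2 (diff (Pi.single i 1) f) := by
  have hv : v = ∑ i : Fin d, (v i).val • (Pi.single i 1 : Site d n) := by
    funext j
    rw [Finset.sum_apply, Finset.sum_eq_single j]
    · simp
    · intro i _ hij; simp [hij.symm]
    · simp
  conv_lhs => rw [hv]
  refine (l2_diff_sum_le _ _ _).trans ?_
  rw [Finset.mul_sum]
  refine Finset.sum_le_sum fun i _ => (l2_diff_nsmul_le _ _ _).trans ?_
  gcongr
  · exact l2_nonneg _
  · exact (ZMod.val_lt (v i)).le

lemma sum_sq_diff (f : Site d n → ℝ) :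
    ∑ i : Fin d, l2 (diff (Pi.single i 1) f) ^ 2 = (2 * (d : ℝ)) * -∑ x, f x * laplacian f x := by
  rw [sum_mul_laplacian]
  rcases Nat.eq_zero_or_pos d with rfl | hd
  · simp
  simp only [l2_sq, diff, ← pow_two]
  field_simp

/-- **Poincaré inequality** on the discrete torus. -/
lemma l2_le_laplacian (f : Site d n → ℝ) (hf : ∑ x, f x = 0) :
    l2 f ≤ (n : ℝ) ^ 2 * (d : ℝ) ^ 2 * l2 (laplacian f) := by
  set E : ℝ := -∑ x, f x * laplacian f x with hE
  have hCS : E ≤ l2 f * l2 (laplacian f) := by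
    have := abs_real_inner_le_norm (WithLp.toLp 2 f) (WithLp.toLp 2 (laplacian f))
    rw [EuclideanSpace.inner_eq_star_dotProduct] at this
    simp only [dotProduct, star_trivial] at this
    refine (neg_le_abs _).trans (le_trans (le_of_eq ?_) this)
    congr 1
    exact Finset.sum_congr rfl fun x _ => mul_comm _ _
  -- Every difference, not only a unit one, is controlled by the Dirichlet energy `E`.
  have h1 : ∀ v : Site d n, l2 (diff v f) ^ 2 ≤ (n : ℝ) ^ 2 * (d * (2 * d * E)) := by
    intro v
    calc l2 (diff v f) ^ 2 ≤ (n * ∑ i : Fin d, l2 (diff (Pi.single i 1) f)) ^ 2 :=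
          pow_le_pow_left₀ (l2_nonneg _) (l2_diff_le f v) 2
      _ = (n : ℝ) ^ 2 * (∑ i : Fin d, l2 (diff (Pi.single i 1) f)) ^ 2 := by ring
      _ ≤ (n : ℝ) ^ 2 * (d * ∑ i : Fin d, l2 (diff (Pi.single i 1) f) ^ 2) := by
          gcongr
          simpa using sq_sum_le_card_mul_sum_sq (s := Finset.univ)
            (f := fun i : Fin d => l2 (diff (Pi.single i 1) f))
      _ = _ := by rw [sum_sq_diff]
  -- Summed over all `v`, the cross terms form `(∑ f)² = 0`; this is where the mean-zero hypothesis
  -- enters.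
  have h2 : ∑ v : Site d n, l2 (diff v f) ^ 2 = Fintype.card (Site d n) * (2 * l2 f ^ 2) := by
    simp only [l2_sq, diff]
    have : ∀ v : Site d n, ∑ x, (f (x + v) - f x) ^ 2 =
        2 * ∑ x, f x ^ 2 - 2 * ∑ x, f x * f (x + v) := by
      intro v
      have e := sum_translate (fun x => f x ^ 2) v
      calc _ = ∑ x, (f (x + v) ^ 2 + f x ^ 2 - 2 * (f x * f (x + v))) :=
            Finset.sum_congr rfl fun x _ => by ring
        _ = _ := by
          rw [Finset.sum_sub_distrib, Finset.sum_add_distrib, e, ← Finset.mul_sum]; ring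
    simp only [this, Finset.sum_sub_distrib, ← Finset.mul_sum]
    have h0 : ∑ v : Site d n, ∑ x, f x * f (x + v) = 0 := by
      rw [Finset.sum_comm]
      refine Finset.sum_eq_zero fun x _ => ?_
      have e : ∑ v, f (x + v) = ∑ v, f v := Equiv.sum_comp (Equiv.addLeft x) f
      rw [← Finset.mul_sum, e, hf, mul_zero]
    rw [h0, Finset.sum_const, Finset.card_univ, nsmul_eq_mul]
    ring
  have hcard : (0 : ℝ) < Fintype.card (Site d n) := by exact_mod_cast Fintype.card_pos
  have h3 : l2 f ^ 2 ≤ (n : ℝ) ^ 2 * (d : ℝ) ^ 2 * E := by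
    have := Finset.sum_le_sum fun v (_ : v ∈ (Finset.univ : Finset (Site d n))) => h1 v
    rw [h2, Finset.sum_const, Finset.card_univ, nsmul_eq_mul] at this
    have := le_of_mul_le_mul_left this hcard
    linarith
  rcases (l2_nonneg f).eq_or_lt with h0 | h0
  · rw [← h0]; have := l2_nonneg (laplacian f); positivity
  · have : l2 f * l2 f ≤ l2 f * ((n : ℝ) ^ 2 * (d : ℝ) ^ 2 * l2 (laplacian f)) := by
      calc l2 f * l2 f = l2 f ^ 2 := by ring
        _ ≤ (n : ℝ) ^ 2 * (d : ℝ) ^ 2 * E := h3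
        _ ≤ (n : ℝ) ^ 2 * (d : ℝ) ^ 2 * (l2 f * l2 (laplacian f)) := by gcongr
        _ = _ := by ring
    exact le_of_mul_le_mul_left this h0

/-- The functions of mean zero on the discrete torus. -/
def meanZero (d : ℕ) (n : ℕ+) : Submodule ℝ (Site d n → ℝ) where
  carrier := {f | ∑ x, f x = 0}
  add_mem' {f g} hf hg := by
    simp only [Set.mem_ofPred_eq, Pi.add_apply, Finset.sum_add_distrib] at *
    rw [hf, hg, add_zero]
  zero_mem' := by simp
  smul_mem' c f hf := by
    simp only [Set.mem_ofPred_eq, Pi.smul_apply, ← Finset.smul_sum] at *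
    rw [hf, smul_zero]

/-- The Poisson equation is solvable for right-hand sides of mean zero. -/
lemma exists_laplacian_eq (f : Site d n → ℝ) (hf : ∑ x, f x = 0) :
    ∃ g : Site d n → ℝ, ∑ x, g x = 0 ∧ laplacian g = f := by
  let T : meanZero d n →ₗ[ℝ] meanZero d n :=
    (laplacianLM d n).restrict (fun g _ => sum_laplacian g)
  -- The Poincaré inequality kills the kernel on mean-zero functions; in finite dimension
  -- injectivity gives surjectivity.
  have hinj : Function.Injective T := by
    rw [← LinearMap.ker_eq_bot, LinearMap.ker_eq_bot']
    rintro ⟨g, hg⟩ h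
    have h0 : laplacian g = 0 := congrArg Subtype.val h
    have := l2_le_laplacian g hg
    rw [h0] at this
    have hz : l2 (0 : Site d n → ℝ) = 0 := by simp [l2]
    rw [hz, mul_zero] at this
    have h1 : l2 g = 0 := le_antisymm this (l2_nonneg _)
    have h2 : WithLp.toLp 2 g = 0 := norm_eq_zero.mp h1
    ext x
    exact congrFun (congrArg WithLp.ofLp h2) x
  obtain ⟨⟨g, hg⟩, h⟩ := (LinearMap.injective_iff_surjective.mp hinj) ⟨f, hf⟩
  exact ⟨g, hg, congrArg Subtype.val h⟩

/-! ### Stabilisation -/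

lemma excess_nonneg (s : Site d n → ℝ) (x : Site d n) : 0 ≤ excess s x := le_max_right _ _

lemma laplacian_zero : laplacian (0 : Site d n → ℝ) = 0 := map_zero (laplacianLM d n)

lemma topple_iterate (s : Site d n → ℝ) (t : ℕ) :
    topple^[t] s = s + laplacian (emittedUpTo s t) := by
  induction t with
  | zero =>
    have : emittedUpTo s 0 = 0 := by funext x; simp [emittedUpTo]
    simp [this, laplacian_zero]
  | succ t ih =>
    have h : emittedUpTo s (t + 1) = emittedUpTo s t + excess (topple^[t] s) := by
      funext x; simp [emittedUpTo, Finset.sum_range_succ]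
    rw [Function.iterate_succ_apply', h, laplacian_add, ← add_assoc, ← ih]
    rfl

/-- A closed recursion for the emitted mass alone, from which monotonicity, the least action
principle and the limit equation are all read off. -/
lemma emittedUpTo_succ (s : Site d n → ℝ) (t : ℕ) (x : Site d n) :
    emittedUpTo s (t + 1) x =
      max (emittedUpTo s t x + (s x + laplacian (emittedUpTo s t) x - 1)) (emittedUpTo s t x) := by
  have : excess (topple^[t] s) x = max (s x + laplacian (emittedUpTo s t) x - 1) 0 := by
    rw [topple_iterate]; rfl
  simp only [emittedUpTo, Finset.sum_range_succ] at this ⊢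
  rw [this, ← max_add_add_left, add_zero]

/-- `f + Δf` is the average of `f` over the `2d` neighbours. -/
lemma add_laplacian_mono (hd : 1 ≤ d) {f g : Site d n → ℝ} (h : ∀ x, f x ≤ g x) (x : Site d n) :
    f x + laplacian f x ≤ g x + laplacian g x := by
  have hd' : (0 : ℝ) < d := by exact_mod_cast hd
  have key : ∀ f : Site d n → ℝ, f x + laplacian f x =
      (1 / (2 * (d : ℝ))) * ∑ i : Fin d, (f (x + Pi.single i 1) + f (x - Pi.single i 1)) := by
    intro f
    simp only [laplacian]
    have : ∑ i : Fin d, ((f (x + Pi.single i 1) - f x) + (f (x - Pi.single i 1) - f x)) =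
        ∑ i : Fin d, (f (x + Pi.single i 1) + f (x - Pi.single i 1)) - d * (2 * f x) := by
      rw [eq_sub_iff_add_eq]
      have : (d : ℝ) * (2 * f x) = ∑ i : Fin d, 2 * f x := by simp
      rw [this, ← Finset.sum_add_distrib]
      exact Finset.sum_congr rfl fun i _ => by ring
    rw [this]; field_simp; ring
  rw [key, key]
  gcongr <;> exact h _

/-- **Least action principle.** -/
lemma emittedUpTo_le (hd : 1 ≤ d) {s w : Site d n → ℝ} (hw : ∀ x, 0 ≤ w x)
    (hs : ∀ x, s x + laplacian w x ≤ 1) (t : ℕ) (x : Site d n) : emittedUpTo s t x ≤ w x := by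
  induction t generalizing x with
  | zero => simpa [emittedUpTo] using hw x
  | succ t ih =>
    rw [emittedUpTo_succ]
    refine max_le ?_ (ih x)
    have := add_laplacian_mono hd ih x
    linarith [hs x]

lemma emittedUpTo_mono (s : Site d n → ℝ) (x : Site d n) : Monotone fun t => emittedUpTo s t x :=
  monotone_nat_of_le_succ fun t => by rw [emittedUpTo_succ]; exact le_max_right _ _

lemma emittedUpTo_nonneg (s : Site d n → ℝ) (t : ℕ) (x : Site d n) : 0 ≤ emittedUpTo s t x :=
  Finset.sum_nonneg fun _ _ => excess_nonneg _ _

/-- A solution of `Δg = 1 - s`, shifted by a constant to be nonnegative, stabilises `s`, so the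
least action principle makes it a bound uniform in time. -/
lemma exists_emittedUpTo_le (hd : 1 ≤ d) (s : Site d n → ℝ) (hs : ∑ x, (s x - 1) = 0) :
    ∃ w : Site d n → ℝ, ∀ t x, emittedUpTo s t x ≤ w x := by
  obtain ⟨g, -, hg⟩ := exists_laplacian_eq (fun x => 1 - s x)
    (by rw [← neg_eq_zero, ← Finset.sum_neg_distrib]; simpa using hs)
  obtain ⟨m, hm⟩ := (Set.finite_range g).bddBelow
  refine ⟨fun x => g x - m, fun t x =>
    emittedUpTo_le (w := fun x => g x - m) hd (fun x => ?_) (fun x => ?_) t x⟩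
  · exact sub_nonneg.mpr (hm ⟨x, rfl⟩)
  · rw [laplacian_sub_const, hg]; simp

lemma emitted_ne_top (hd : 1 ≤ d) (s : Site d n → ℝ) (hs : ∑ x, (s x - 1) = 0) (x : Site d n) :
    emitted s x ≠ ∞ := by
  obtain ⟨w, hw⟩ := exists_emittedUpTo_le hd s hs
  refine ne_top_of_le_ne_top ENNReal.ofReal_ne_top (iSup_le fun t => ?_ : _ ≤ ENNReal.ofReal (w x))
  exact ENNReal.ofReal_le_ofReal (hw t x)

lemma tendsto_emittedUpTo (hd : 1 ≤ d) (s : Site d n → ℝ) (hs : ∑ x, (s x - 1) = 0)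
    (x : Site d n) :
    Tendsto (fun t => emittedUpTo s t x) atTop (𝓝 (emitted s x).toReal) := by
  have h : Tendsto (fun t => ENNReal.ofReal (emittedUpTo s t x)) atTop (𝓝 (emitted s x)) :=
    tendsto_atTop_iSup fun a b hab => ENNReal.ofReal_le_ofReal (emittedUpTo_mono s x hab)
  have := (ENNReal.tendsto_toReal (emitted_ne_top hd s hs x)).comp h
  refine this.congr fun t => ?_
  simp [ENNReal.toReal_ofReal (emittedUpTo_nonneg s t x)]

/-- The final configuration is at most `1` everywhere, and toppling conserves total mass, which
equals the number of sites; hence it is `1` everywhere. -/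
lemma laplacian_emitted (hd : 1 ≤ d) (s : Site d n → ℝ) (hs : ∑ x, (s x - 1) = 0) (x : Site d n) :
    laplacian (fun y => (emitted s y).toReal) x = 1 - s x := by
  set e : Site d n → ℝ := fun y => (emitted s y).toReal with he
  have hlim := tendsto_emittedUpTo hd s hs
  have hL : ∀ x, Tendsto (fun t => laplacian (emittedUpTo s t) x) atTop (𝓝 (laplacian e x)) := by
    intro x
    simp only [laplacian]
    refine Tendsto.const_mul _ (tendsto_finsetSum _ fun i _ => ?_)
    exact ((hlim _).sub (hlim _)).add ((hlim _).sub (hlim _))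
  have hle : ∀ x, s x + laplacian e x - 1 ≤ 0 := by
    intro x
    have h1 : Tendsto (fun t => emittedUpTo s (t + 1) x) atTop (𝓝 (e x)) :=
      (hlim x).comp (tendsto_add_atTop_nat 1)
    have h2 : Tendsto (fun t => emittedUpTo s t x + (s x + laplacian (emittedUpTo s t) x - 1))
        atTop (𝓝 (e x + (s x + laplacian e x - 1))) :=
      (hlim x).add (((hL x).const_add _).sub_const _)
    have := le_of_tendsto_of_tendsto' h2 h1 fun t => by
      rw [emittedUpTo_succ]; exact le_max_left _ _
    linarith
  have hsum : ∑ x, (s x + laplacian e x - 1) = 0 := by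
    have : ∀ x, s x + laplacian e x - 1 = (s x - 1) + laplacian e x := fun x => by ring
    simp only [this, Finset.sum_add_distrib, hs, sum_laplacian, add_zero]
  have := (Finset.sum_eq_zero_iff_of_nonpos fun x _ => hle x).mp hsum x (Finset.mem_univ x)
  linarith

lemma laplacian_odometer (hd : 1 ≤ d) (s : Site d n → ℝ) (hs : ∑ x, (s x - 1) = 0)
    (x : Site d n) : laplacian (odometer s) x = (1 - s x) / (2 * d) := by
  have : odometer s = (1 / (2 * (d : ℝ))) • fun y => (emitted s y).toReal := by
    funext y; simp [odometer, div_eq_inv_mul]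
  rw [this, laplacian_smul, Pi.smul_apply, laplacian_emitted hd s hs, smul_eq_mul]
  ring

lemma card_site : Fintype.card (Site d n) = (n : ℕ) ^ d := by
  simp [ZMod.card]

lemma sum_initialConfig (σ : Site d n → ℝ) : ∑ x, (initialConfig σ x - 1) = 0 := by
  have : ∀ x, initialConfig σ x - 1 = σ x - (1 / (n : ℝ) ^ d) * ∑ z, σ z := fun x => by
    simp only [initialConfig]; ring
  simp only [this, Finset.sum_sub_distrib, Finset.sum_const, Finset.card_univ, card_site,
    nsmul_eq_mul]
  have : (n : ℝ) ≠ 0 := by exact_mod_cast n.pos.ne'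
  push_cast
  field_simp
  ring

/-- Summation against the odometer in terms of the initial field. -/
lemma sum_odometer_mul_laplacian (hd : 1 ≤ d) (σ : Site d n → ℝ) (H : Site d n → ℝ)
    (hH : ∑ x, H x = 0) :
    2 * d * ∑ x, odometer (initialConfig σ) x * laplacian H x = - ∑ x, σ x * H x := by
  have hd' : (d : ℝ) ≠ 0 := by positivity
  rw [sum_mul_laplacian_comm, Finset.mul_sum]
  have : ∀ x, 2 * d * (laplacian (odometer (initialConfig σ)) x * H x) =
      -(σ x * H x) + (1 / (n : ℝ) ^ d) * (∑ z, σ z) * H x := fun x => by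
    rw [laplacian_odometer hd _ (sum_initialConfig σ)]
    simp only [initialConfig]
    field_simp
    ring
  simp only [this, Finset.sum_add_distrib, Finset.sum_neg_distrib, ← Finset.mul_sum, hH, mul_zero,
    add_zero]

end Discrete

/-! ### Cells of the torus and Riemann sums -/

section Cells

variable {d : ℕ} {n : ℕ+}

lemma volume_unitAddCircle : (volume : Measure UnitAddCircle) = AddCircle.haarAddCircle := by
  rw [AddCircle.volume_eq_smul_haarAddCircle, ENNReal.ofReal_one, one_smul]

instance : IsProbabilityMeasure (volume : Measure UnitAddCircle) := ⟨by simp⟩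

instance : IsProbabilityMeasure (volume : Measure (UnitAddTorus (Fin d))) :=
  Measure.pi.instIsProbabilityMeasure _

lemma mFourierCoeff_eq_integral_volume (f : UnitAddTorus (Fin d) → ℂ) (z : Fin d → ℤ) :
    UnitAddTorus.mFourierCoeff f z = ∫ x, UnitAddTorus.mFourier (-z) x * f x := by
  have : (volume : Measure (UnitAddTorus (Fin d))) =
      Measure.pi fun _ => AddCircle.haarAddCircle := by
    rw [volume_pi]; simp only [volume_unitAddCircle]
  rw [this]
  rfl

/-- The point `y/n` of the torus. -/
def sitePt (y : Site d n) : UnitAddTorus (Fin d) := fun i => ZMod.toAddCircle (y i)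

/-- The cell around `y/n`. -/
def cell (y : Site d n) : Set (UnitAddTorus (Fin d)) := Metric.ball (sitePt y) (1 / (2 * (n : ℝ)))

lemma pnat_pos (n : ℕ+) : (0 : ℝ) < n := by exact_mod_cast n.pos

lemma measurableSet_cell (y : Site d n) : MeasurableSet (cell y) := measurableSet_ball

lemma volume_cell (y : Site d n) : volume.real (cell y) = 1 / (n : ℝ) ^ d := by
  have hn := pnat_pos n
  have hr : 0 < 1 / (2 * (n : ℝ)) := by positivity
  have h1 : (1 : ℝ) ≤ n := by exact_mod_cast n.pos
  have key : ∀ a : UnitAddCircle, volume (Metric.ball a (1 / (2 * (n : ℝ)))) =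
      ENNReal.ofReal (1 / n) := by
    intro a
    have h := AddCircle.volume_closedBall (T := 1) (x := a) (1 / (2 * (n : ℝ)))
    rw [← measure_congr (AddCircle.closedBall_ae_eq_ball (T := 1) (x := a)), h]
    congr 1
    rw [min_eq_right]
    · field_simp
    · field_simp; exact h1
  rw [Measure.real, cell, volume_pi_ball _ hr]
  simp only [key, Finset.prod_const, Finset.card_univ, Fintype.card_fin, ENNReal.toReal_pow]
  rw [ENNReal.toReal_ofReal (by positivity), div_pow, one_pow]

/-- Multiplied by `n`, the distance to the nearest integer becomes the absolute value of an integer,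
which is `0` once it is less than `1`. -/
lemma eq_zero_of_norm_toAddCircle_lt (k : ZMod n) (h : ‖ZMod.toAddCircle k‖ < 1 / (n : ℝ)) :
    k = 0 := by
  have hn := pnat_pos n
  obtain ⟨j, rfl⟩ := ZMod.intCast_surjective k
  rw [ZMod.toAddCircle_intCast, UnitAddCircle.norm_eq, ← mul_lt_mul_iff_right₀ hn] at h
  set r := round ((j : ℝ) / (n : ℕ))
  have e : (n : ℝ) * |(j : ℝ) / (n : ℕ) - r| = |((j - n * r : ℤ) : ℝ)| := by
    rw [← abs_of_pos hn, ← abs_mul, abs_of_pos hn]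
    congr 1
    push_cast
    field_simp
  rw [e, mul_one_div_cancel hn.ne', ← Int.cast_abs] at h
  have h0 : |j - n * r| < 1 := by exact_mod_cast h
  have h1 : j = n * r := by rw [Int.abs_lt_one_iff] at h0; linarith
  rw [h1]; simp

lemma pairwise_disjoint_cell : Pairwise (Function.onFun Disjoint (cell : Site d n → Set _)) := by
  intro y y' hne
  refine Set.disjoint_left.mpr fun x hx hx' => hne ?_
  have hn := pnat_pos n
  have : dist (sitePt y) (sitePt y') < 1 / n := by
    have := dist_triangle_left (sitePt y) (sitePt y') x
    have h1 := Metric.mem_ball.mp hx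
    have h2 := Metric.mem_ball.mp hx'
    calc _ < 1 / (2 * (n : ℝ)) + 1 / (2 * (n : ℝ)) := by linarith
      _ = 1 / n := by field_simp; norm_num
  funext i
  have hi := (dist_le_pi_dist (sitePt y) (sitePt y') i).trans_lt this
  rw [dist_eq_norm, sitePt, sitePt, ← map_sub] at hi
  exact sub_eq_zero.mp (eq_zero_of_norm_toAddCircle_lt _ hi)

/-- There are `n^d` disjoint cells of volume `n^{-d}`, so what the open balls miss is null. -/
lemma iUnion_cell_ae_eq : (⋃ y : Site d n, cell y) =ᵐ[volume] Set.univ := by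
  rw [ae_eq_univ, prob_compl_eq_zero_iff (MeasurableSet.iUnion measurableSet_cell)]
  have h : volume.real (⋃ y : Site d n, cell y) = 1 := by
    rw [measureReal_iUnion_fintype pairwise_disjoint_cell measurableSet_cell]
    have hn := (pnat_pos n).ne'
    simp only [volume_cell, Finset.sum_const, Finset.card_univ, card_site, nsmul_eq_mul]
    push_cast
    field_simp
  rwa [Measure.real, ENNReal.toReal_eq_one_iff] at h

lemma integral_eq_sum_cell {φ : UnitAddTorus (Fin d) → ℝ} (hφ : Integrable φ) (n : ℕ+) :
    ∫ x, φ x = ∑ y : Site d n, ∫ x in cell y, φ x := by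
  rw [← integral_iUnion_fintype measurableSet_cell pairwise_disjoint_cell
    fun y => hφ.integrableOn, setIntegral_congr_set iUnion_cell_ae_eq, setIntegral_univ]

lemma continuous_of_lift {f : UnitAddTorus (Fin d) → ℝ} (hf : Continuous (lift f)) :
    Continuous f := by
  have hq : IsOpenQuotientMap (fun (v : Fin d → ℝ) (i : Fin d) => (v i : UnitAddCircle)) :=
    IsOpenQuotientMap.piMap fun _ => QuotientAddGroup.isOpenQuotientMap_mk
  exact hq.isQuotientMap.continuous_iff.mpr hf

lemma continuous_smoothFun (f : SmoothFun d) : Continuous f.1 :=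
  continuous_of_lift (ContDiff.continuous (n := ((⊤ : ℕ∞) : WithTop ℕ∞)) f.2)

lemma integrable_of_continuous {E : Type*} [NormedAddCommGroup E]
    {φ : UnitAddTorus (Fin d) → E} (hφ : Continuous φ) : Integrable φ :=
  hφ.integrable_of_hasCompactSupport (HasCompactSupport.of_compactSpace φ)

lemma fieldPair_eq_sum (s : Site d n → ℝ) (f : SmoothFun d) :
    fieldPair s f = ∑ y, odometer s y * ∫ x in cell y, f.1 x := by
  have h : ∀ x, odometerField s x * f.1 x =
      ∑ y : Site d n, (cell y).indicator (fun x => odometer s y * f.1 x) x := by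
    intro x
    rw [odometerField, Finset.sum_mul]
    refine Finset.sum_congr rfl fun y _ => ?_
    change (cell y).indicator _ x * _ = _
    by_cases hx : x ∈ cell y <;> simp [hx]
  simp only [fieldPair, h]
  rw [integral_finsetSum]
  · refine Finset.sum_congr rfl fun y _ => ?_
    rw [integral_indicator (measurableSet_cell y), integral_const_mul]
  · intro y _
    exact ((integrable_of_continuous (continuous_smoothFun f)).const_mul _).indicator (measurableSet_cell y)

/-- Averages over small cells are uniformly close to the values at the centres. -/
lemma eventually_cell_average {φ : UnitAddTorus (Fin d) → ℝ} (hφ : Continuous φ) {ε : ℝ}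
    (hε : 0 < ε) : ∀ᶠ n : ℕ+ in atTop, ∀ y : Site d n,
      |(n : ℝ) ^ d * (∫ x in cell y, φ x) - φ (sitePt y)| ≤ ε := by
  obtain ⟨δ, hδ, h⟩ := Metric.uniformContinuous_iff.mp
    (CompactSpace.uniformContinuous_of_continuous hφ) ε hε
  obtain ⟨N, hN⟩ := exists_nat_gt (1 / δ)
  refine (eventually_ge_atTop N.succPNat).mono fun n hn y => ?_
  have hn0 := pnat_pos n
  have hnN : (N : ℝ) ≤ n := by
    have : (N.succPNat : ℕ) ≤ n := hn
    have : N ≤ (n : ℕ) := by simp at this; omega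
    exact_mod_cast this
  have hlt : 1 / (2 * (n : ℝ)) < δ := by
    have h1 : 1 / δ < n := hN.trans_le hnN
    rw [div_lt_iff₀ hδ] at h1
    rw [div_lt_iff₀ (by positivity)]
    linarith [mul_pos hn0 hδ]
  have hi : IntegrableOn φ (cell y) := (integrable_of_continuous hφ).integrableOn
  have e : (n : ℝ) ^ d * (∫ x in cell y, φ x) - φ (sitePt y) =
      (n : ℝ) ^ d * ∫ x in cell y, (φ x - φ (sitePt y)) := by
    rw [integral_sub hi (integrable_const _), setIntegral_const, volume_cell, smul_eq_mul]
    field_simp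
  rw [e, abs_mul, abs_of_pos (by positivity), mul_comm, ← le_div_iff₀ (by positivity)]
  have hb := norm_setIntegral_le_of_norm_le_const (f := fun x => φ x - φ (sitePt y)) (s := cell y)
    (C := ε) (measure_lt_top volume _) fun x hx => (h ((Metric.mem_ball.mp hx).trans hlt)).le
  rwa [volume_cell, mul_one_div] at hb

/-- Riemann sums of continuous functions on the torus converge to the integral. -/
lemma tendsto_riemann_sum {φ : UnitAddTorus (Fin d) → ℝ} (hφ : Continuous φ) :
    Tendsto (fun n : ℕ+ => (1 / (n : ℝ) ^ d) * ∑ y : Site d n, φ (sitePt y)) atTop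
      (𝓝 (∫ x, φ x)) := by
  rw [Metric.tendsto_nhds]
  intro ε hε
  filter_upwards [eventually_cell_average hφ (half_pos hε)] with n hn
  have hn0 := pnat_pos n
  have e : (1 / (n : ℝ) ^ d) * ∑ y : Site d n, φ (sitePt y) - ∫ x, φ x =
      -((1 / (n : ℝ) ^ d) *
        ∑ y : Site d n, ((n : ℝ) ^ d * (∫ x in cell y, φ x) - φ (sitePt y))) := by
    rw [integral_eq_sum_cell (integrable_of_continuous hφ) n, Finset.sum_sub_distrib,
      ← Finset.mul_sum]
    field_simp
    ring
  rw [Real.dist_eq, e, abs_neg, abs_mul, abs_of_pos (by positivity)]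
  calc _ ≤ 1 / (n : ℝ) ^ d * ∑ y : Site d n, ε / 2 := by
        gcongr
        exact (Finset.abs_sum_le_sum_abs _ _).trans (Finset.sum_le_sum fun y _ => hn y)
    _ = ε / 2 := by
        rw [Finset.sum_const, Finset.card_univ, card_site, nsmul_eq_mul]
        push_cast
        field_simp
    _ < ε := half_lt_self hε

end Cells

/-! ### Fourier coefficients of smooth functions -/

section Fourier

variable {d : ℕ}

lemma mFourier_apply_add (z : Fin d → ℤ) (x y : UnitAddTorus (Fin d)) :
    UnitAddTorus.mFourier z (x + y) = UnitAddTorus.mFourier z x * UnitAddTorus.mFourier z y := by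
  simp only [UnitAddTorus.mFourier, ContinuousMap.coe_mk, ← Finset.prod_mul_distrib, Pi.add_apply,
    fourier_apply, smul_add, AddCircle.toCircle_add, Circle.coe_mul]

lemma mFourier_apply_neg (z : Fin d → ℤ) (x : UnitAddTorus (Fin d)) :
    UnitAddTorus.mFourier z (-x) = UnitAddTorus.mFourier (-z) x := by
  simp only [UnitAddTorus.mFourier, ContinuousMap.coe_mk, Pi.neg_apply, fourier_apply, smul_neg,
    neg_smul]

lemma norm_mFourier_apply (z : Fin d → ℤ) (x : UnitAddTorus (Fin d)) :
    ‖UnitAddTorus.mFourier z x‖ = 1 := by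
  simp only [UnitAddTorus.mFourier, ContinuousMap.coe_mk, norm_prod, fourier_apply,
    Circle.norm_coe, Finset.prod_const_one]

lemma mFourier_single_coe (z : Fin d → ℤ) (i : Fin d) (t : ℝ) :
    UnitAddTorus.mFourier z (Pi.single i (t : UnitAddCircle)) =
      Complex.exp (2 * Real.pi * Complex.I * z i * t) := by
  simp only [UnitAddTorus.mFourier, ContinuousMap.coe_mk]
  rw [Finset.prod_eq_single i]
  · rw [Pi.single_eq_same, fourier_coe_apply]; simp
  · intro j _ hj
    rw [Pi.single_eq_of_ne hj]; simp
  · simp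

/-- The Fourier coefficient of a smooth function. -/
def coef (f : SmoothFun d) (z : Fin d → ℤ) : ℂ :=
  UnitAddTorus.mFourierCoeff (fun y => (f.1 y : ℂ)) z

lemma coef_eq (f : SmoothFun d) (z : Fin d → ℤ) :
    coef f z = ∫ x, UnitAddTorus.mFourier (-z) x * (f.1 x : ℂ) :=
  mFourierCoeff_eq_integral_volume _ _

lemma continuous_coef_integrand (f : SmoothFun d) (z : Fin d → ℤ) :
    Continuous fun x => UnitAddTorus.mFourier (-z) x * (f.1 x : ℂ) :=
  (ContinuousMap.continuous _).mul (Complex.continuous_ofReal.comp (continuous_smoothFun f))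

lemma coef_add (f g : SmoothFun d) (z : Fin d → ℤ) : coef (f + g) z = coef f z + coef g z := by
  simp only [coef_eq]
  rw [← integral_add (integrable_of_continuous (continuous_coef_integrand f z))
    (integrable_of_continuous (continuous_coef_integrand g z))]
  refine integral_congr_ae (ae_of_all _ fun x => ?_)
  simp [mul_add]

lemma coef_smul (a : ℝ) (f : SmoothFun d) (z : Fin d → ℤ) : coef (a • f) z = a * coef f z := by
  simp only [coef_eq]
  rw [← integral_const_mul]
  refine integral_congr_ae (ae_of_all _ fun x => ?_)
  simp only [Submodule.coe_smul, Pi.smul_apply, smul_eq_mul, Complex.ofReal_mul]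
  ring

lemma coef_neg (f : SmoothFun d) (z : Fin d → ℤ) : coef f (-z) = star (coef f z) := by
  simp only [coef_eq]
  rw [← starRingEnd_apply, ← integral_conj]
  refine integral_congr_ae (ae_of_all _ fun x => ?_)
  simp only [map_mul, Complex.conj_ofReal, ← UnitAddTorus.mFourier_neg]

lemma norm_coef_le (f : SmoothFun d) (z : Fin d → ℤ) {B : ℝ} (hB : ∀ x, |f.1 x| ≤ B) :
    ‖coef f z‖ ≤ B := by
  rw [coef_eq]
  refine (norm_integral_le_of_norm_le_const (C := B) (ae_of_all _ fun x => ?_)).trans (by simp)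
  rw [norm_mul, norm_mFourier_apply, one_mul, Complex.norm_real]
  exact hB x

/-- The class on the torus of a vector. -/
def toTorus (v : Fin d → ℝ) : UnitAddTorus (Fin d) := fun i => (v i : UnitAddCircle)

lemma toTorus_surjective : Function.Surjective (toTorus (d := d)) := by
  intro x
  choose v hv using fun i => QuotientAddGroup.mk_surjective (x i)
  exact ⟨v, funext hv⟩

/-- The increment of a smooth function along `v`. -/
def shiftDiff (v : Fin d → ℝ) (f : SmoothFun d) : SmoothFun d :=
  ⟨fun x => f.1 (x + toTorus v) - f.1 x, by
    have hf : ContDiff ℝ ((⊤ : ℕ∞) : WithTop ℕ∞) (lift f.1) := f.2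
    have h : ContDiff ℝ ((⊤ : ℕ∞) : WithTop ℕ∞) fun w => lift f.1 (w + v) - lift f.1 w :=
      (hf.comp (contDiff_id.add contDiff_const)).sub hf
    exact h⟩

lemma lift_shiftDiff (v : Fin d → ℝ) (f : SmoothFun d) :
    lift (shiftDiff v f).1 = (fun w => lift f.1 (w + v)) - lift f.1 := rfl

lemma contDiff_lift (f : SmoothFun d) : ContDiff ℝ ((⊤ : ℕ∞) : WithTop ℕ∞) (lift f.1) := f.2

lemma norm_iteratedFDeriv_shiftDiff_le (v : Fin d → ℝ) (f : SmoothFun d) {j : ℕ} {B : ℝ}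
    (hB : ∀ w, ‖iteratedFDeriv ℝ (j + 1) (lift f.1) w‖ ≤ B) (w : Fin d → ℝ) :
    ‖iteratedFDeriv ℝ j (lift (shiftDiff v f).1) w‖ ≤ B * ‖v‖ := by
  have hj : ((j : ℕ) : WithTop ℕ∞) ≤ ((⊤ : ℕ∞) : WithTop ℕ∞) := by exact_mod_cast le_top
  have hf := (contDiff_lift f).of_le hj
  have hf' : ContDiff ℝ (j : WithTop ℕ∞) fun w => lift f.1 (w + v) :=
    hf.comp (contDiff_id.add contDiff_const)
  rw [lift_shiftDiff, iteratedFDeriv_sub_apply hf'.contDiffAt hf.contDiffAt,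
    iteratedFDeriv_comp_add_right]
  have := Convex.norm_image_sub_le_of_norm_fderiv_le (𝕜 := ℝ) (s := Set.univ)
    (f := iteratedFDeriv ℝ j (lift f.1)) (C := B) (x := w) (y := w + v)
    (fun x _ => ((contDiff_lift f).differentiable_iteratedFDeriv
      (by exact_mod_cast ENat.natCast_lt_top j)) x)
    (fun x _ => by rw [norm_fderiv_iteratedFDeriv]; exact hB x) convex_univ trivial trivial
  simpa using this

/-- By the mean value inequality each difference trades one derivative for a factor `‖v‖`. -/
lemma abs_iterate_shiftDiff_le (v : Fin d → ℝ) (k : ℕ) (f : SmoothFun d) {B : ℝ}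
    (hB : ∀ w, ‖iteratedFDeriv ℝ k (lift f.1) w‖ ≤ B) (x : UnitAddTorus (Fin d)) :
    |((shiftDiff v)^[k] f).1 x| ≤ B * ‖v‖ ^ k := by
  induction k generalizing f B with
  | zero =>
    obtain ⟨w, rfl⟩ := toTorus_surjective x
    have := hB w
    rw [norm_iteratedFDeriv_zero] at this
    simpa using! this
  | succ k ih =>
    rw [Function.iterate_succ_apply, pow_succ', ← mul_assoc]
    exact ih _ (norm_iteratedFDeriv_shiftDiff_le v f hB)

lemma coef_shiftDiff (v : Fin d → ℝ) (f : SmoothFun d) (z : Fin d → ℤ) :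
    coef (shiftDiff v f) z = (UnitAddTorus.mFourier z (toTorus v) - 1) * coef f z := by
  have h := integral_add_right_eq_self (μ := (volume : Measure (UnitAddTorus (Fin d))))
    (fun x => UnitAddTorus.mFourier (-z) (x - toTorus v) * (f.1 x : ℂ)) (toTorus v)
  simp only [add_sub_cancel_right] at h
  have hc : Continuous fun x => UnitAddTorus.mFourier (-z) x * (f.1 (x + toTorus v) : ℂ) :=
    (ContinuousMap.continuous _).mul (Complex.continuous_ofReal.comp
      ((continuous_smoothFun f).comp (continuous_add_const _)))
  have h1 : coef (shiftDiff v f) z =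
      (∫ x, UnitAddTorus.mFourier (-z) x * (f.1 (x + toTorus v) : ℂ)) - coef f z := by
    rw [coef_eq, coef_eq, ← integral_sub (integrable_of_continuous hc)
      (integrable_of_continuous (continuous_coef_integrand f z))]
    refine integral_congr_ae (ae_of_all _ fun x => ?_)
    simp [shiftDiff, mul_sub]
  rw [h1, h, sub_mul, one_mul, coef_eq, ← integral_const_mul]
  congr 1
  refine integral_congr_ae (ae_of_all _ fun x => ?_)
  simp only [sub_eq_add_neg, mFourier_apply_add, mFourier_apply_neg, neg_neg]
  ring

lemma coef_iterate_shiftDiff (v : Fin d → ℝ) (k : ℕ) (f : SmoothFun d) (z : Fin d → ℤ) :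
    coef ((shiftDiff v)^[k] f) z =
      (UnitAddTorus.mFourier z (toTorus v) - 1) ^ k * coef f z := by
  induction k with
  | zero => simp
  | succ k ih => rw [Function.iterate_succ_apply', coef_shiftDiff, ih, pow_succ']; ring

/-- Polynomial decay of Fourier coefficients. -/
lemma norm_coef_le_of_iteratedFDeriv (f : SmoothFun d) (k : ℕ) {B : ℝ}
    (hB : ∀ w, ‖iteratedFDeriv ℝ k (lift f.1) w‖ ≤ B) (z : Fin d → ℤ) (hz : z ≠ 0) :
    ‖coef f z‖ ≤ B * ‖z‖⁻¹ ^ k := by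
  have hd : Nonempty (Fin d) := by
    by_contra h
    exact hz (funext fun i => (h ⟨i⟩).elim)
  obtain ⟨i, hi⟩ := Finite.exists_max fun i => ‖z i‖
  have hzi : ‖z‖ = ‖z i‖ :=
    le_antisymm ((pi_norm_le_iff_of_nonneg (norm_nonneg _)).mpr hi) (norm_le_pi_norm z i)
  have hzi0 : (z i : ℝ) ≠ 0 := by
    intro h
    have : ‖z‖ = 0 := by rw [hzi, Int.norm_eq_abs, h, abs_zero]
    exact hz (norm_eq_zero.mp this)
  -- Half a period of the mode `z` along its largest coordinate: the multiplier is `-1 - 1 = -2`, as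
  -- far from `0` as possible, while `‖v‖ = 1 / (2‖z‖)`.
  set v : Fin d → ℝ := Pi.single i (1 / (2 * (z i : ℝ))) with hv
  have hvn : ‖v‖ = 2⁻¹ * ‖z‖⁻¹ := by
    rw [hv, Pi.norm_single, hzi, Int.norm_eq_abs, Real.norm_eq_abs, abs_div, abs_mul]
    simp [mul_comm]
  have hvt : toTorus v = Pi.single i ((1 / (2 * (z i : ℝ)) : ℝ) : UnitAddCircle) := by
    funext j
    by_cases hj : j = i
    · subst hj; simp [toTorus, hv]
    · simp [toTorus, hv, hj]
  have hm : UnitAddTorus.mFourier z (toTorus v) = -1 := by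
    rw [hvt, mFourier_single_coe, ← Complex.exp_pi_mul_I]
    congr 1
    have : ((z i : ℝ) : ℂ) ≠ 0 := by exact_mod_cast hzi0
    push_cast at this ⊢
    field_simp
  have h1 := norm_coef_le ((shiftDiff v)^[k] f) z (abs_iterate_shiftDiff_le v k f hB)
  rw [coef_iterate_shiftDiff, hm, norm_mul, norm_pow, hvn, mul_pow] at h1
  have e : ‖(-1 - 1 : ℂ)‖ = 2 := by norm_num
  rw [e] at h1
  have hB0 : 0 ≤ B := (norm_nonneg _).trans (hB 0)
  have h2 : ‖coef f z‖ ≤ 2 ^ k * ‖coef f z‖ :=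
    le_mul_of_one_le_left (norm_nonneg _) (one_le_pow₀ (by norm_num))
  refine h2.trans (h1.trans ?_)
  have h3 : (2⁻¹ : ℝ) ^ k ≤ 1 := pow_le_one₀ (by norm_num) (by norm_num)
  have h4 : 0 ≤ ‖z‖⁻¹ ^ k := by positivity
  exact mul_le_mul_of_nonneg_left (mul_le_of_le_one_left h4 h3) hB0

/-- By periodicity a bound on the unit cube suffices. -/
lemma exists_iteratedFDeriv_le (f : SmoothFun d) (k : ℕ) :
    ∃ B, ∀ w, ‖iteratedFDeriv ℝ k (lift f.1) w‖ ≤ B := by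
  have hc : Continuous (iteratedFDeriv ℝ k (lift f.1)) :=
    (contDiff_lift f).continuous_iteratedFDeriv (by exact_mod_cast le_top)
  have hK : IsCompact (Set.pi Set.univ fun _ : Fin d => Set.Icc (0 : ℝ) 1) :=
    isCompact_univ_pi fun _ => isCompact_Icc
  obtain ⟨B, hB⟩ := hK.exists_bound_of_continuousOn hc.continuousOn
  refine ⟨B, fun w => ?_⟩
  set m : Fin d → ℝ := fun i => (⌊w i⌋ : ℝ) with hm
  have hper : (fun u => lift f.1 (u + m)) = lift f.1 := by
    funext u
    refine congrArg f.1 (funext fun i => ?_)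
    simp [hm]
  have e : iteratedFDeriv ℝ k (lift f.1) w =
      iteratedFDeriv ℝ k (lift f.1) (fun i => Int.fract (w i)) := by
    conv_rhs => rw [← hper, iteratedFDeriv_comp_add_right]
    congr 1
    funext i
    simp [hm]
  rw [e]
  exact hB _ fun i _ => ⟨Int.fract_nonneg _, (Int.fract_lt_one _).le⟩

lemma summable_norm_inv_pow {k : ℕ} (hk : d < k) :
    Summable fun z : Fin d → ℤ => ‖z‖⁻¹ ^ k := by
  set b := Pi.basisFun ℝ (Fin d)
  set Λ : Submodule ℤ (Fin d → ℝ) := Submodule.span ℤ (Set.range b)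
  have h := ZLattice.summable_norm_pow_inv Λ k (by
    rw [ZLattice.rank ℝ Λ]; simpa using hk)
  have hmem : ∀ z : Fin d → ℤ, (fun i => (z i : ℝ)) ∈ Λ := fun z => by
    rw [(b.mem_span_iff_repr_mem ℤ _)]
    intro i
    exact ⟨z i, by simp [b]⟩
  have hinj : Function.Injective fun z : Fin d → ℤ => (⟨fun i => (z i : ℝ), hmem z⟩ : Λ) := by
    intro z z' hzz
    funext i
    have : (z i : ℝ) = z' i := congrFun (congrArg Subtype.val hzz) i
    exact_mod_cast this
  refine (h.comp_injective hinj).congr fun z => ?_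
  have : ‖(fun i => (z i : ℝ))‖ = ‖z‖ := by
    rw [Pi.norm_def, Pi.norm_def]
    exact congrArg _ (Finset.sup_congr rfl fun i _ => by ext; simp [Int.norm_eq_abs])
  simp [this]

lemma summable_norm_coef (f : SmoothFun d) : Summable fun z => ‖coef f z‖ := by
  obtain ⟨B, hB⟩ := exists_iteratedFDeriv_le f (d + 1)
  refine Summable.of_norm_bounded_eventually ((summable_norm_inv_pow (Nat.lt_succ_self d)).mul_left B)
    ((Set.finite_singleton (0 : Fin d → ℤ)).subset fun z hz => ?_)
  by_contra h
  refine hz ?_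
  change ‖‖coef f z‖‖ ≤ _
  rw [norm_norm]
  exact norm_coef_le_of_iteratedFDeriv f (d + 1) hB z h

lemma hasSum_coef (f : SmoothFun d) (x : UnitAddTorus (Fin d)) :
    HasSum (fun z => coef f z * UnitAddTorus.mFourier z x) (f.1 x : ℂ) := by
  let F : C(UnitAddTorus (Fin d), ℂ) :=
    ⟨fun y => (f.1 y : ℂ), Complex.continuous_ofReal.comp (continuous_smoothFun f)⟩
  exact UnitAddTorus.hasSum_mFourier_series_apply_of_summable (f := F)
    (summable_norm_coef f).of_norm x

end Fourier

/-! ### The potential of a smooth function and its discrete Laplacian -/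

section Potential

variable {d : ℕ}

/-- The squared Euclidean norm of a frequency. -/
def freqSq (z : Fin d → ℤ) : ℝ := ∑ i, (z i : ℝ) ^ 2

lemma one_le_freqSq {z : Fin d → ℤ} (hz : z ≠ 0) : 1 ≤ freqSq z := by
  obtain ⟨i, hi⟩ := Function.ne_iff.mp hz
  have h1 : (1 : ℝ) ≤ (z i : ℝ) ^ 2 := by
    have : 0 < z i ^ 2 := by have : z i ≠ 0 := hi; positivity
    exact_mod_cast this
  exact h1.trans (Finset.single_le_sum (f := fun i => (z i : ℝ) ^ 2) (fun _ _ => sq_nonneg _)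
    (Finset.mem_univ i))

lemma fourierTerm_eq (f : SmoothFun d) (x : UnitAddTorus (Fin d)) (z : {z : Fin d → ℤ // z ≠ 0}) :
    fourierTerm f x z = UnitAddTorus.mFourier (-z.1) x * coef f z.1 / (freqSq z.1 : ℂ) := rfl

lemma norm_fourierTerm_le (f : SmoothFun d) (x : UnitAddTorus (Fin d))
    (z : {z : Fin d → ℤ // z ≠ 0}) : ‖fourierTerm f x z‖ ≤ ‖coef f z.1‖ := by
  have h := one_le_freqSq z.2
  rw [fourierTerm_eq, norm_div, norm_mul, norm_mFourier_apply, one_mul, Complex.norm_real,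
    Real.norm_of_nonneg (by linarith)]
  exact div_le_self (norm_nonneg _) h

lemma summable_norm_coef_subtype (f : SmoothFun d) :
    Summable fun z : {z : Fin d → ℤ // z ≠ 0} => ‖coef f z.1‖ :=
  (summable_norm_coef f).subtype _

lemma summable_fourierTerm (f : SmoothFun d) (x : UnitAddTorus (Fin d)) :
    Summable (fourierTerm f x) :=
  Summable.of_norm_bounded (summable_norm_coef_subtype f) (norm_fourierTerm_le f x)

/-- The real part of the Fourier series of the potential of `f`. -/
def potential (f : SmoothFun d) (x : UnitAddTorus (Fin d)) : ℝ :=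
  ∑' z, (fourierTerm f x z).re

lemma hasSum_potential (f : SmoothFun d) (x : UnitAddTorus (Fin d)) :
    HasSum (fun z => (fourierTerm f x z).re) (potential f x) :=
  (Complex.hasSum_re (summable_fourierTerm f x).hasSum).summable.hasSum

lemma potential_eq_re (f : SmoothFun d) (x : UnitAddTorus (Fin d)) :
    potential f x = (∑' z, fourierTerm f x z).re :=
  (Complex.hasSum_re (summable_fourierTerm f x).hasSum).tsum_eq

lemma continuous_fourierTerm (f : SmoothFun d) (z : {z : Fin d → ℤ // z ≠ 0}) :
    Continuous fun x => fourierTerm f x z := by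
  simp only [fourierTerm_eq]
  exact ((ContinuousMap.continuous _).mul continuous_const).div_const _

lemma abs_re_fourierTerm_le (f : SmoothFun d) (x : UnitAddTorus (Fin d))
    (z : {z : Fin d → ℤ // z ≠ 0}) : ‖(fourierTerm f x z).re‖ ≤ ‖coef f z.1‖ :=
  (Complex.abs_re_le_norm _).trans (norm_fourierTerm_le f x z)

lemma continuous_potential (f : SmoothFun d) : Continuous (potential f) :=
  continuous_tsum (fun z => Complex.continuous_re.comp (continuous_fourierTerm f z))
    (summable_norm_coef_subtype f) fun z x => abs_re_fourierTerm_le f x z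

lemma freqSq_neg (z : Fin d → ℤ) : freqSq (-z) = freqSq z := by simp [freqSq]

/-- The potential of a real function is real. -/
lemma tsum_fourierTerm (f : SmoothFun d) (x : UnitAddTorus (Fin d)) :
    ∑' z, fourierTerm f x z = (potential f x : ℂ) := by
  -- Conjugation exchanges the terms at `z` and `-z`, because `f` is real.
  have hconj : starRingEnd ℂ (∑' z, fourierTerm f x z) = ∑' z, fourierTerm f x z := by
    rw [Complex.conj_tsum]
    let e : {z : Fin d → ℤ // z ≠ 0} ≃ {z : Fin d → ℤ // z ≠ 0} :=
      (Equiv.neg _).subtypeEquiv fun z => by simp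
    rw [← e.tsum_eq (fourierTerm f x)]
    refine tsum_congr fun z => ?_
    have he : (e z).1 = -z.1 := rfl
    rw [fourierTerm_eq, fourierTerm_eq, he, freqSq_neg, coef_neg, map_div₀, map_mul,
      Complex.conj_ofReal, UnitAddTorus.mFourier_neg, UnitAddTorus.mFourier_neg,
      starRingEnd_apply, starRingEnd_apply, star_star, ← starRingEnd_apply, UnitAddTorus.mFourier_neg,
      Complex.conj_conj]
  rw [potential_eq_re]
  exact (Complex.conj_eq_iff_re.mp hconj).symm

lemma norm_tsum_fourierTerm (f : SmoothFun d) (x : UnitAddTorus (Fin d)) :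
    ‖∑' z, fourierTerm f x z‖ = |potential f x| := by
  rw [tsum_fourierTerm, Complex.norm_real, Real.norm_eq_abs]

lemma potential_smul (a : ℝ) (f : SmoothFun d) (x : UnitAddTorus (Fin d)) :
    potential (a • f) x = a * potential f x := by
  refine HasSum.unique (hasSum_potential (a • f) x) ?_
  refine ((hasSum_potential f x).mul_left a).congr_fun fun z => ?_
  rw [fourierTerm_eq, fourierTerm_eq, coef_smul, ← Complex.re_ofReal_mul]
  congr 1
  ring

/-- A translation by half a period reverses the sign of a nonzero mode, so each term integrates to
`0`. Consequently the lattice mean of the potential vanishes in the limit, as needed to compare it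
with the mean-zero `H`. -/
lemma integral_potential (f : SmoothFun d) : ∫ x, potential f x = 0 := by
  have hint : ∀ z : {z : Fin d → ℤ // z ≠ 0}, ∫ x, fourierTerm f x z = 0 := by
    intro z
    have h0 : (∫ x, UnitAddTorus.mFourier (-z.1) x : ℂ) = 0 := by
      obtain ⟨i, hi⟩ := Function.ne_iff.mp z.2
      have hi' : (z.1 i : ℂ) ≠ 0 := by exact_mod_cast hi
      set v : UnitAddTorus (Fin d) := Pi.single i ((1 / (2 * (z.1 i : ℝ)) : ℝ) : UnitAddCircle)
      have hm : UnitAddTorus.mFourier (-z.1) v = -1 := by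
        rw [mFourier_single_coe]
        have e : 2 * (Real.pi : ℂ) * Complex.I * ((-z.1) i : ℤ) *
            ((1 / (2 * (z.1 i : ℝ)) : ℝ) : ℂ) = -(Real.pi * Complex.I) := by
          push_cast [Pi.neg_apply]
          field_simp
        rw [e, Complex.exp_neg, Complex.exp_pi_mul_I]; norm_num
      have h := integral_add_right_eq_self (μ := (volume : Measure (UnitAddTorus (Fin d))))
        (fun x => (UnitAddTorus.mFourier (-z.1) x : ℂ)) v
      simp only [mFourier_apply_add, hm, mul_neg, mul_one, integral_neg] at h
      exact self_eq_neg.mp h.symm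
    simp only [fourierTerm_eq, mul_div_assoc]
    rw [integral_mul_const, h0, zero_mul]
  have hsum := hasSum_integral_of_summable_integral_norm
    (F := fun z x => (fourierTerm f x z).re) (μ := (volume : Measure (UnitAddTorus (Fin d))))
    (fun z => integrable_of_continuous (Complex.continuous_re.comp (continuous_fourierTerm f z)))
    (Summable.of_nonneg_of_le (fun z => integral_nonneg fun _ => norm_nonneg _)
      (fun z => by
        refine (integral_mono_of_nonneg (ae_of_all _ fun _ => norm_nonneg _)
          (integrable_const _) (ae_of_all _ fun x => abs_re_fourierTerm_le f x z)).trans ?_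
        simp) (summable_norm_coef_subtype f))
  have hz : ∀ z : {z : Fin d → ℤ // z ≠ 0}, ∫ x, (fourierTerm f x z).re = 0 := fun z => by
    have := integral_re (𝕜 := ℂ) (integrable_of_continuous (continuous_fourierTerm f z))
    rw [hint z] at this
    simpa using this
  simp only [hz] at hsum
  exact (hsum.unique hasSum_zero)

/-- The rescaled eigenvalue `n² λ_z / 4π²` of the discrete Laplacian. -/
def discreteFreqSq (n : ℕ+) (z : Fin d → ℤ) : ℝ :=
  ∑ i, ((z i : ℝ) * Real.sinc (Real.pi * z i / n)) ^ 2

lemma discreteFreqSq_nonneg (n : ℕ+) (z : Fin d → ℤ) : 0 ≤ discreteFreqSq n z :=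
  Finset.sum_nonneg fun _ _ => sq_nonneg _

lemma discreteFreqSq_le (n : ℕ+) (z : Fin d → ℤ) : discreteFreqSq n z ≤ freqSq z := by
  refine Finset.sum_le_sum fun i _ => ?_
  rw [mul_pow]
  refine mul_le_of_le_one_right (sq_nonneg _) ?_
  rw [← sq_abs]
  exact pow_le_one₀ (abs_nonneg _) (Real.abs_sinc_le_one _)

lemma tendsto_pnat_cast_atTop : Tendsto (fun n : ℕ+ => (n : ℝ)) atTop atTop :=
  tendsto_natCast_atTop_atTop.comp tendsto_PNat_val_atTop_atTop

lemma tendsto_discreteFreqSq (z : Fin d → ℤ) :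
    Tendsto (fun n : ℕ+ => discreteFreqSq n z) atTop (𝓝 (freqSq z)) := by
  refine tendsto_finsetSum _ fun i _ => ?_
  have h : Tendsto (fun n : ℕ+ => Real.pi * z i / (n : ℝ)) atTop (𝓝 0) :=
    tendsto_const_nhds.div_atTop tendsto_pnat_cast_atTop
  have h2 := (Real.continuous_sinc.tendsto 0).comp h
  rw [Real.sinc_zero] at h2
  simpa using (h2.const_mul (z i : ℝ)).pow 2

/-- From `2 - 2 cos 2t = 4 sin² t` and `sin t = t sinc t`. The `sinc` form includes `k = 0` and
yields both the bound by `‖z‖²` and the limit. -/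
lemma sq_mul_two_sub_two_cos (n : ℕ+) (k : ℤ) :
    (n : ℝ) ^ 2 * (2 - 2 * Real.cos (2 * Real.pi * k / n)) =
      4 * Real.pi ^ 2 * ((k : ℝ) * Real.sinc (Real.pi * k / n)) ^ 2 := by
  have hn := pnat_pos n
  set t := Real.pi * k / n with ht
  have h1 : 2 * Real.pi * k / n = 2 * t := by rw [ht]; ring
  have h2 : Real.sin t = t * Real.sinc t := by
    by_cases h : t = 0
    · simp [h]
    · rw [Real.sinc_of_ne_zero h]; field_simp
  have h3 : (n : ℝ) * t = Real.pi * k := by rw [ht]; field_simp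
  rw [h1, Real.cos_two_mul, Real.cos_sq', h2]
  calc _ = 4 * (n * t) ^ 2 * Real.sinc t ^ 2 := by ring
    _ = _ := by rw [h3]; ring

lemma sitePt_add (n : ℕ+) (x y : Site d n) : sitePt (x + y) = sitePt x + sitePt y := by
  funext i; simp [sitePt]

lemma sitePt_sub (n : ℕ+) (x y : Site d n) : sitePt (x - y) = sitePt x - sitePt y := by
  funext i; simp [sitePt]

lemma sitePt_single (n : ℕ+) (i : Fin d) :
    sitePt (Pi.single i 1 : Site d n) = Pi.single i ((1 / (n : ℝ) : ℝ) : UnitAddCircle) := by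
  funext j
  by_cases hj : j = i
  · subst hj
    have := ZMod.toAddCircle_intCast (N := n) 1
    simp only [Int.cast_one] at this
    simp [sitePt, this]
  · simp [sitePt, hj]

lemma laplacian_re_mFourier (hd : 1 ≤ d) (n : ℕ+) (z : Fin d → ℤ) (w : ℂ) (x : Site d n) :
    2 * d * (n : ℝ) ^ 2 * laplacian (fun y => (UnitAddTorus.mFourier z (sitePt y) * w).re) x =
      -(4 * Real.pi ^ 2 * discreteFreqSq n z) * (UnitAddTorus.mFourier z (sitePt x) * w).re := by
  have hd' : (d : ℝ) ≠ 0 := by positivity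
  set u := UnitAddTorus.mFourier z (sitePt x) * w with hu
  have key : ∀ i : Fin d,
      ((UnitAddTorus.mFourier z (sitePt (x + Pi.single i 1)) * w).re - u.re) +
      ((UnitAddTorus.mFourier z (sitePt (x - Pi.single i 1)) * w).re - u.re) =
      -(2 - 2 * Real.cos (2 * Real.pi * z i / n)) * u.re := by
    intro i
    set θ : ℝ := 2 * Real.pi * z i / n with hθ
    have e1 : UnitAddTorus.mFourier z (sitePt (Pi.single i 1 : Site d n)) =
        Complex.exp (θ * Complex.I) := by
      rw [sitePt_single, mFourier_single_coe, hθ]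
      congr 1; push_cast; ring
    have e2 : UnitAddTorus.mFourier z (-sitePt (Pi.single i 1 : Site d n)) =
        Complex.exp (-(θ * Complex.I)) := by
      rw [mFourier_apply_neg, UnitAddTorus.mFourier_neg, e1, ← Complex.exp_conj]
      simp
    have e3 : UnitAddTorus.mFourier z (sitePt (x + Pi.single i 1)) * w +
        UnitAddTorus.mFourier z (sitePt (x - Pi.single i 1)) * w =
        ((2 * Real.cos θ : ℝ) : ℂ) * u := by
      rw [sitePt_add, sitePt_sub, sub_eq_add_neg, mFourier_apply_add, mFourier_apply_add, e1, e2, hu]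
      push_cast
      rw [Complex.cos, neg_mul]
      ring
    have e4 := congrArg Complex.re e3
    rw [Complex.add_re, Complex.re_ofReal_mul] at e4
    linear_combination e4
  simp only [laplacian]
  rw [Finset.sum_congr rfl fun i _ => key i, ← Finset.sum_mul]
  have e5 : (n : ℝ) ^ 2 * ∑ i, -(2 - 2 * Real.cos (2 * Real.pi * z i / n)) =
      -(4 * Real.pi ^ 2 * discreteFreqSq n z) := by
    simp only [Finset.sum_neg_distrib, mul_neg, Finset.mul_sum, sq_mul_two_sub_two_cos,
      discreteFreqSq]
  rw [← e5]
  field_simp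

/-- The error in the discrete Poisson equation. -/
def poissonError (f : SmoothFun d) (n : ℕ+) : ℝ :=
  ∑' z : {z : Fin d → ℤ // z ≠ 0},
    ‖coef f z.1‖ * |4 * Real.pi ^ 2 * (1 - discreteFreqSq n z.1 / freqSq z.1)|

lemma abs_one_sub_div_le (n : ℕ+) (z : {z : Fin d → ℤ // z ≠ 0}) :
    |4 * Real.pi ^ 2 * (1 - discreteFreqSq n z.1 / freqSq z.1)| ≤ 4 * Real.pi ^ 2 := by
  have h1 := one_le_freqSq z.2
  have h2 : discreteFreqSq n z.1 / freqSq z.1 ≤ 1 :=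
    div_le_one_of_le₀ (discreteFreqSq_le n z.1) (by linarith)
  have h3 : 0 ≤ discreteFreqSq n z.1 / freqSq z.1 :=
    div_nonneg (discreteFreqSq_nonneg n z.1) (by linarith)
  rw [abs_mul, abs_of_nonneg (by positivity : 0 ≤ 4 * Real.pi ^ 2)]
  refine mul_le_of_le_one_right (by positivity) ?_
  rw [abs_le]; constructor <;> linarith

lemma summable_poissonError (f : SmoothFun d) (n : ℕ+) :
    Summable fun z : {z : Fin d → ℤ // z ≠ 0} =>
      ‖coef f z.1‖ * |4 * Real.pi ^ 2 * (1 - discreteFreqSq n z.1 / freqSq z.1)| :=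
  Summable.of_nonneg_of_le (fun _ => by positivity)
    (fun z => mul_le_mul_of_nonneg_left (abs_one_sub_div_le n z) (norm_nonneg _))
    ((summable_norm_coef_subtype f).mul_right _)

lemma tendsto_poissonError (f : SmoothFun d) : Tendsto (poissonError f) atTop (𝓝 0) := by
  have h := tendsto_tsum_of_dominated_convergence (𝓕 := (atTop : Filter ℕ+))
    (f := fun n (z : {z : Fin d → ℤ // z ≠ 0}) =>
      ‖coef f z.1‖ * |4 * Real.pi ^ 2 * (1 - discreteFreqSq n z.1 / freqSq z.1)|)
    (g := fun _ => 0) (bound := fun z => ‖coef f z.1‖ * (4 * Real.pi ^ 2))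
    ((summable_norm_coef_subtype f).mul_right _) (fun z => ?_)
    (Eventually.of_forall fun n z => ?_)
  · rw [tsum_zero] at h
    exact h
  · have h0 : freqSq z.1 ≠ 0 := (zero_lt_one.trans_le (one_le_freqSq z.2)).ne'
    have := (((((tendsto_discreteFreqSq z.1).div_const (freqSq z.1)).const_sub 1).const_mul
      (4 * Real.pi ^ 2)).abs).const_mul ‖coef f z.1‖
    simpa [div_self h0] using this
  · rw [Real.norm_of_nonneg (by positivity)]
    exact mul_le_mul_of_nonneg_left (abs_one_sub_div_le n z) (norm_nonneg _)

/-- The potential solves the discrete Poisson equation up to a uniformly small error. -/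
lemma abs_laplacian_potential_le (hd : 1 ≤ d) (f : SmoothFun d) (hf : ∫ x, f.1 x = 0) (n : ℕ+)
    (x : Site d n) :
    |2 * d * (n : ℝ) ^ 2 * laplacian (fun y => potential f (-sitePt y)) x +
      4 * Real.pi ^ 2 * f.1 (sitePt x)| ≤ poissonError f n := by
  have hT : ∀ (y : Site d n) (z : {z : Fin d → ℤ // z ≠ 0}), (fourierTerm f (-sitePt y) z).re =
      (UnitAddTorus.mFourier z.1 (sitePt y) * (coef f z.1 / (freqSq z.1 : ℂ))).re := by
    intro y z
    rw [fourierTerm_eq, mFourier_apply_neg, neg_neg, mul_div_assoc]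
  have h1 : HasSum (fun z : {z : Fin d → ℤ // z ≠ 0} =>
      laplacian (fun y => (fourierTerm f (-sitePt y) z).re) x)
      (laplacian (fun y => potential f (-sitePt y)) x) := by
    simp only [laplacian]
    refine HasSum.mul_left _ (hasSum_sum fun i _ => ?_)
    exact ((hasSum_potential f _).sub (hasSum_potential f _)).add
      ((hasSum_potential f _).sub (hasSum_potential f _))
  -- The potential omits the zero frequency, so the full Fourier series of `f` is matched only
  -- because `f` has mean zero.
  have h0 : coef f 0 = 0 := by
    rw [coef_eq]
    simp only [neg_zero, UnitAddTorus.mFourier_zero, ContinuousMap.one_apply, one_mul]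
    rw [integral_complex_ofReal, hf, Complex.ofReal_zero]
  have h2 : HasSum (fun z : {z : Fin d → ℤ // z ≠ 0} =>
      (coef f z.1 * UnitAddTorus.mFourier z.1 (sitePt x)).re) (f.1 (sitePt x)) := by
    have := Complex.hasSum_re (hasSum_coef f (sitePt x))
    rw [Complex.ofReal_re] at this
    refine (hasSum_subtype_iff_of_support_subset (s := {z : Fin d → ℤ | z ≠ 0}) ?_).mpr this
    intro z hz hz0
    subst hz0
    simp [h0] at hz
  have h3 := (h1.mul_left (2 * d * (n : ℝ) ^ 2)).add (h2.mul_left (4 * Real.pi ^ 2))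
  rw [← h3.tsum_eq, ← Real.norm_eq_abs]
  refine tsum_of_norm_bounded (summable_poissonError f n).hasSum fun z => ?_
  have hz0 : freqSq z.1 ≠ 0 := (zero_lt_one.trans_le (one_le_freqSq z.2)).ne'
  simp only [hT]
  rw [laplacian_re_mFourier hd]
  have e : (coef f z.1 * UnitAddTorus.mFourier z.1 (sitePt x)).re =
      freqSq z.1 * (UnitAddTorus.mFourier z.1 (sitePt x) * (coef f z.1 / (freqSq z.1 : ℂ))).re := by
    rw [← Complex.re_ofReal_mul]
    congr 1
    have : (freqSq z.1 : ℂ) ≠ 0 := by exact_mod_cast hz0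
    field_simp
  have hn : |(coef f z.1 * UnitAddTorus.mFourier z.1 (sitePt x)).re| ≤ ‖coef f z.1‖ := by
    refine (Complex.abs_re_le_norm _).trans ?_
    rw [norm_mul, norm_mFourier_apply, mul_one]
  have e2 : -(4 * Real.pi ^ 2 * discreteFreqSq n z.1) *
      (UnitAddTorus.mFourier z.1 (sitePt x) * (coef f z.1 / (freqSq z.1 : ℂ))).re +
      4 * Real.pi ^ 2 * (coef f z.1 * UnitAddTorus.mFourier z.1 (sitePt x)).re =
      (coef f z.1 * UnitAddTorus.mFourier z.1 (sitePt x)).re *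
        (4 * Real.pi ^ 2 * (1 - discreteFreqSq n z.1 / freqSq z.1)) := by
    rw [e]; field_simp; ring
  rw [e2, Real.norm_eq_abs, abs_mul]
  exact mul_le_mul_of_nonneg_right hn (abs_nonneg _)

end Potential

/-! ### The discrete Green kernel applied to a smooth function -/

section Kernel

variable {d : ℕ}

/-- Cell averages, rather than values at lattice points, make the pairing identity exact, and they
sum to exactly `0`, so the equation is solvable. -/
lemma exists_kernel (hd : 1 ≤ d) (f : SmoothFun d) (hf : ∫ x, f.1 x = 0) (n : ℕ+) :
    ∃ H : Site d n → ℝ, ∑ x, H x = 0 ∧ ∀ x, 2 * d * (n : ℝ) ^ 2 * laplacian H x =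
      -(4 * Real.pi ^ 2) * ((n : ℝ) ^ d * ∫ t in cell x, f.1 t) := by
  have hn := pnat_pos n
  have hd' : (d : ℝ) ≠ 0 := by positivity
  obtain ⟨H, h0, hH⟩ := exists_laplacian_eq (n := n) (fun x => (2 * d * (n : ℝ) ^ 2)⁻¹ *
    (-(4 * Real.pi ^ 2) * ((n : ℝ) ^ d * ∫ t in cell x, f.1 t))) (by
      rw [← Finset.mul_sum, ← Finset.mul_sum, ← Finset.mul_sum,
        ← integral_eq_sum_cell (integrable_of_continuous (continuous_smoothFun f)), hf]
      simp)
  refine ⟨H, h0, fun x => ?_⟩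
  rw [hH]
  field_simp

/-- The scaled pairing of the odometer field with a test function is a weighted sum of the initial
field. -/
lemma scaling_mul_fieldPair (hd : 1 ≤ d) (α : ℝ) (f : SmoothFun d) {n : ℕ+} {H : Site d n → ℝ}
    (h0 : ∑ x, H x = 0) (hH : ∀ x, 2 * d * (n : ℝ) ^ 2 * laplacian H x =
      -(4 * Real.pi ^ 2) * ((n : ℝ) ^ d * ∫ t in cell x, f.1 t)) (σ : Site d n → ℝ) :
    scaling d α n * fieldPair (initialConfig σ) f =
      ∑ x, (n : ℝ) ^ (-((d : ℝ) / α)) * H x * σ x := by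
  have hn := pnat_pos n
  have hs : scaling d α n =
      4 * Real.pi ^ 2 * ((n : ℝ) ^ d * (n : ℝ) ^ (-((d : ℝ) / α)) / (n : ℝ) ^ 2) := by
    rw [scaling, Real.rpow_sub hn, sub_eq_add_neg, Real.rpow_add hn, Real.rpow_natCast]
    norm_num
  have h1 := sum_odometer_mul_laplacian hd σ H h0
  rw [Finset.mul_sum] at h1
  have h2 : ∀ x, 2 * d * (odometer (initialConfig σ) x * laplacian H x) =
      -(4 * Real.pi ^ 2) * (n : ℝ) ^ d / (n : ℝ) ^ 2 *
        (odometer (initialConfig σ) x * ∫ t in cell x, f.1 t) := by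
    intro x
    have := hH x
    field_simp
    linear_combination odometer (initialConfig σ) x * this
  simp only [h2, ← Finset.mul_sum] at h1
  rw [fieldPair_eq_sum, hs]
  have h3 : ∑ x, (n : ℝ) ^ (-((d : ℝ) / α)) * H x * σ x =
      (n : ℝ) ^ (-((d : ℝ) / α)) * ∑ x, σ x * H x := by
    rw [Finset.mul_sum]; exact Finset.sum_congr rfl fun x _ => by ring
  rw [h3]
  linear_combination -(n : ℝ) ^ (-((d : ℝ) / α)) * h1

/-- The largest deviation of the averages over the cells from the values at their centres. -/
def cellError (f : SmoothFun d) (n : ℕ+) : ℝ :=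
  ⨆ y : Site d n, |(n : ℝ) ^ d * (∫ x in cell y, f.1 x) - f.1 (sitePt y)|

lemma le_cellError (f : SmoothFun d) {n : ℕ+} (y : Site d n) :
    |(n : ℝ) ^ d * (∫ x in cell y, f.1 x) - f.1 (sitePt y)| ≤ cellError f n :=
  le_ciSup (f := fun y : Site d n => |(n : ℝ) ^ d * (∫ x in cell y, f.1 x) - f.1 (sitePt y)|)
    (Set.finite_range _).bddAbove y

lemma tendsto_cellError (f : SmoothFun d) : Tendsto (cellError f) atTop (𝓝 0) := by
  rw [Metric.tendsto_nhds]
  intro ε hε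
  filter_upwards [eventually_cell_average (continuous_smoothFun f) (half_pos hε)] with n hn
  rw [Real.dist_eq, sub_zero, abs_of_nonneg ((abs_nonneg _).trans (le_cellError f 0))]
  exact (ciSup_le hn).trans_lt (half_lt_self hε)

/-- The mean of the potential over the points of the discrete torus. -/
def potentialMean (f : SmoothFun d) (n : ℕ+) : ℝ :=
  (1 / (n : ℝ) ^ d) * ∑ y : Site d n, potential f (-sitePt y)

lemma sum_neg_sitePt (φ : UnitAddTorus (Fin d) → ℝ) (n : ℕ+) :
    ∑ y : Site d n, φ (-sitePt y) = ∑ y : Site d n, φ (sitePt y) := by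
  rw [← Equiv.sum_comp (Equiv.neg (Site d n))]
  refine Finset.sum_congr rfl fun y _ => congrArg φ ?_
  funext i
  simp [sitePt]

lemma tendsto_potentialMean (f : SmoothFun d) : Tendsto (potentialMean f) atTop (𝓝 0) := by
  have := tendsto_riemann_sum (continuous_potential f)
  rw [integral_potential] at this
  refine this.congr fun n => ?_
  rw [potentialMean, sum_neg_sitePt]

/-- Recentring the potential by its lattice mean makes the difference `D` mean zero, so Poincaré
applies. Its factor `n² d²` cancels the `n^{-2}` in the bound `δ / (2 d n²)` on `ΔD`. The potential
is reflected because `fourierTerm` carries `e^{-2πi z·x}`. -/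
lemma sum_sq_kernel_sub_le (hd : 1 ≤ d) (f : SmoothFun d) (hf : ∫ x, f.1 x = 0) {n : ℕ+}
    {H : Site d n → ℝ}
    (h0 : ∑ x, H x = 0) (hH : ∀ x, 2 * d * (n : ℝ) ^ 2 * laplacian H x =
      -(4 * Real.pi ^ 2) * ((n : ℝ) ^ d * ∫ t in cell x, f.1 t)) :
    (1 / (n : ℝ) ^ d) * ∑ x, (H x - potential f (-sitePt x)) ^ 2 ≤
      (d : ℝ) ^ 2 * (4 * Real.pi ^ 2 * cellError f n + poissonError f n) ^ 2 / 2 +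
        2 * potentialMean f n ^ 2 := by
  have hn := pnat_pos n
  have hd' : (0 : ℝ) < d := by positivity
  set G : Site d n → ℝ := fun x => potential f (-sitePt x) with hG
  set m := potentialMean f n with hm
  set δ := 4 * Real.pi ^ 2 * cellError f n + poissonError f n with hδ
  set D : Site d n → ℝ := H - (fun x => G x - m) with hD
  have hD0 : ∑ x, D x = 0 := by
    simp only [hD, Pi.sub_apply, Finset.sum_sub_distrib, h0, Finset.sum_const, Finset.card_univ,
      card_site, nsmul_eq_mul, hm, potentialMean]
    push_cast
    field_simp
    ring
  have hLD : ∀ x, laplacian D x ^ 2 ≤ (δ / (2 * d * (n : ℝ) ^ 2)) ^ 2 := by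
    intro x
    have h1 : 2 * d * (n : ℝ) ^ 2 * laplacian D x =
        -(4 * Real.pi ^ 2) * ((n : ℝ) ^ d * (∫ t in cell x, f.1 t) - f.1 (sitePt x)) -
          (2 * d * (n : ℝ) ^ 2 * laplacian G x + 4 * Real.pi ^ 2 * f.1 (sitePt x)) := by
      rw [hD, laplacian_sub, laplacian_sub_const, Pi.sub_apply, mul_sub, hH]
      ring
    have h2 : |2 * d * (n : ℝ) ^ 2 * laplacian D x| ≤ δ := by
      rw [h1]
      refine (abs_sub _ _).trans (add_le_add ?_ (abs_laplacian_potential_le hd f hf n x))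
      rw [abs_mul, abs_neg, abs_of_nonneg (by positivity : 0 ≤ 4 * Real.pi ^ 2)]
      exact mul_le_mul_of_nonneg_left (le_cellError f x) (by positivity)
    rw [abs_mul, abs_of_pos (by positivity), mul_comm, ← le_div_iff₀ (by positivity)] at h2
    rw [← sq_abs]
    exact pow_le_pow_left₀ (abs_nonneg _) h2 2
  have hl2 : ∑ x, D x ^ 2 ≤ (n : ℝ) ^ d * ((d : ℝ) ^ 2 * δ ^ 2 / 4) := by
    rw [← l2_sq]
    calc l2 D ^ 2 ≤ ((n : ℝ) ^ 2 * (d : ℝ) ^ 2 * l2 (laplacian D)) ^ 2 :=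
          pow_le_pow_left₀ (l2_nonneg _) (l2_le_laplacian D hD0) 2
      _ = ((n : ℝ) ^ 2 * (d : ℝ) ^ 2) ^ 2 * ∑ x, laplacian D x ^ 2 := by rw [mul_pow, l2_sq]
      _ ≤ ((n : ℝ) ^ 2 * (d : ℝ) ^ 2) ^ 2 * ∑ x : Site d n, (δ / (2 * d * (n : ℝ) ^ 2)) ^ 2 := by
          exact mul_le_mul_of_nonneg_left (Finset.sum_le_sum fun x _ => hLD x) (sq_nonneg _)
      _ = _ := by
          rw [Finset.sum_const, Finset.card_univ, card_site, nsmul_eq_mul]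
          push_cast
          field_simp
          ring
  have hsplit : ∑ x, (H x - G x) ^ 2 ≤ 2 * ∑ x, D x ^ 2 + (n : ℝ) ^ d * (2 * m ^ 2) := by
    have hc : (n : ℝ) ^ d * (2 * m ^ 2) = ∑ x : Site d n, 2 * m ^ 2 := by
      rw [Finset.sum_const, Finset.card_univ, card_site, nsmul_eq_mul]; push_cast; rfl
    rw [hc, Finset.mul_sum, ← Finset.sum_add_distrib]
    refine Finset.sum_le_sum fun x _ => ?_
    simp only [hD, Pi.sub_apply]
    nlinarith [sq_nonneg (H x - (G x - m) + m)]
  calc _ ≤ (1 / (n : ℝ) ^ d) *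
        (2 * ((n : ℝ) ^ d * ((d : ℝ) ^ 2 * δ ^ 2 / 4)) + (n : ℝ) ^ d * (2 * m ^ 2)) := by
        gcongr
        exact hsplit.trans (by linarith)
    _ = _ := by field_simp; ring

end Kernel

/-! ### Means of powers -/

section Powers

/-- For `a` near `b`, uniform continuity on a compact interval gives `ε`; otherwise `|x|^α ≤ 1 +
x²`, valid since `α ≤ 2`, lets the square of the distance dominate. -/
lemma exists_abs_rpow_sub_le {α : ℝ} (hα : 0 < α) (hα2 : α ≤ 2) (M : ℝ) {ε : ℝ} (hε : 0 < ε) :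
    ∃ C : ℝ, ∀ a b : ℝ, |b| ≤ M → |(|a| ^ α - |b| ^ α)| ≤ ε + C * (a - b) ^ 2 := by
  have hcont : Continuous fun x : ℝ => |x| ^ α := continuous_abs.rpow_const fun _ => Or.inr hα.le
  have huc := (isCompact_Icc (a := -(M + 1)) (b := M + 1)).uniformContinuousOn_of_continuous
    hcont.continuousOn
  obtain ⟨δ, hδ, h⟩ := Metric.uniformContinuousOn_iff.mp huc ε hε
  set η := min δ 1 with hη
  have hη0 : 0 < η := lt_min hδ one_pos
  have hpow : ∀ x : ℝ, |x| ^ α ≤ 1 + x ^ 2 := by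
    intro x
    rcases le_total |x| 1 with hx | hx
    · exact (Real.rpow_le_one (abs_nonneg x) hx hα.le).trans (by nlinarith [sq_nonneg x])
    · calc |x| ^ α ≤ |x| ^ (2 : ℝ) := Real.rpow_le_rpow_of_exponent_le hx hα2
        _ = x ^ 2 := by rw [Real.rpow_two, sq_abs]
        _ ≤ _ := by linarith
  -- Away from the diagonal the difference is at most `2 + a² + b² ≤ 2 + 3M² + 2(a - b)²`, and the
  -- constant part is absorbed using `(a - b)² ≥ η²`.
  refine ⟨2 + (2 + 3 * M ^ 2) / η ^ 2, fun a b hb => ?_⟩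
  have hM : 0 ≤ M := (abs_nonneg _).trans hb
  have hb2 : b ^ 2 ≤ M ^ 2 := by rw [← sq_abs]; exact pow_le_pow_left₀ (abs_nonneg _) hb 2
  by_cases hab : |a - b| < η
  · have h1 : |a - b| < 1 := hab.trans_le (min_le_right _ _)
    have hb' := abs_le.mp hb
    have hab' := abs_lt.mp h1
    have := (h a ⟨by linarith, by linarith⟩ b ⟨by linarith, by linarith⟩
      (hab.trans_le (min_le_left _ _))).le
    rw [Real.dist_eq] at this
    have h0 : 0 ≤ (2 + (2 + 3 * M ^ 2) / η ^ 2) * (a - b) ^ 2 := by positivity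
    linarith
  · have h1 : η ^ 2 ≤ (a - b) ^ 2 := by
      rw [← sq_abs (a - b)]; exact pow_le_pow_left₀ hη0.le (not_lt.mp hab) 2
    have h2 : 2 + 3 * M ^ 2 ≤ (2 + 3 * M ^ 2) / η ^ 2 * (a - b) ^ 2 := by
      rw [div_mul_eq_mul_div, le_div_iff₀ (by positivity)]
      exact mul_le_mul_of_nonneg_left h1 (by positivity)
    have h3 : a ^ 2 ≤ 2 * (a - b) ^ 2 + 2 * b ^ 2 := by nlinarith [sq_nonneg (a - 2 * b)]
    have ha := hpow a
    have hb3 := hpow b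
    have ha0 : 0 ≤ |a| ^ α := by positivity
    have hb0 : 0 ≤ |b| ^ α := by positivity
    rw [abs_le]
    constructor <;> nlinarith

variable {d : ℕ}

/-- Means of `α`-th powers are stable under perturbations that are small in mean square. -/
lemma tendsto_mean_abs_rpow {α : ℝ} (hα : 0 < α) (hα2 : α ≤ 2) {M I : ℝ}
    {a b : (n : ℕ+) → Site d n → ℝ} (hb : ∀ n x, |b n x| ≤ M)
    (hab : Tendsto (fun n : ℕ+ => (1 / (n : ℝ) ^ d) * ∑ x, (a n x - b n x) ^ 2) atTop (𝓝 0))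
    (hI : Tendsto (fun n : ℕ+ => (1 / (n : ℝ) ^ d) * ∑ x, |b n x| ^ α) atTop (𝓝 I)) :
    Tendsto (fun n : ℕ+ => (1 / (n : ℝ) ^ d) * ∑ x, |a n x| ^ α) atTop (𝓝 I) := by
  suffices h : Tendsto (fun n : ℕ+ => (1 / (n : ℝ) ^ d) * ∑ x, |a n x| ^ α -
      (1 / (n : ℝ) ^ d) * ∑ x, |b n x| ^ α) atTop (𝓝 0) by
    simpa using h.add hI
  rw [Metric.tendsto_nhds]
  intro ε hε
  obtain ⟨C, hC⟩ := exists_abs_rpow_sub_le hα hα2 M (half_pos hε)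
  have h1 := hab.const_mul C
  rw [mul_zero] at h1
  filter_upwards [h1.eventually_lt_const (half_pos hε)] with n hn
  have hn0 := pnat_pos n
  rw [Real.dist_eq, sub_zero, ← mul_sub, ← Finset.sum_sub_distrib, abs_mul,
    abs_of_pos (by positivity)]
  calc _ ≤ 1 / (n : ℝ) ^ d * ∑ x : Site d n, (ε / 2 + C * (a n x - b n x) ^ 2) := by
        gcongr
        exact (Finset.abs_sum_le_sum_abs _ _).trans
          (Finset.sum_le_sum fun x _ => hC _ _ (hb n x))
    _ = ε / 2 + C * (1 / (n : ℝ) ^ d * ∑ x, (a n x - b n x) ^ 2) := by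
        rw [Finset.sum_add_distrib, Finset.sum_const, Finset.card_univ, card_site, nsmul_eq_mul,
          ← Finset.mul_sum]
        push_cast
        field_simp
    _ < ε := by linarith

/-- After normalisation the weights are uniformly small. -/
lemma eventually_abs_rpow_mul_le (hd : 1 ≤ d) {α : ℝ} (hα : 0 < α) (hα2 : α ≤ 2) {M : ℝ}
    {a b : (n : ℕ+) → Site d n → ℝ} (hb : ∀ n x, |b n x| ≤ M)
    (hab : Tendsto (fun n : ℕ+ => (1 / (n : ℝ) ^ d) * ∑ x, (a n x - b n x) ^ 2) atTop (𝓝 0))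
    {ε : ℝ} (hε : 0 < ε) :
    ∀ᶠ n : ℕ+ in atTop, ∀ x, |(n : ℝ) ^ (-((d : ℝ) / α)) * a n x| ≤ ε := by
  have hd' : (0 : ℝ) < d := by positivity
  have h1 : Tendsto (fun n : ℕ+ => (n : ℝ) ^ (-((d : ℝ) / α)) * M) atTop (𝓝 0) := by
    have := ((tendsto_rpow_neg_atTop (div_pos hd' hα)).comp tendsto_pnat_cast_atTop).mul_const M
    simpa using this
  filter_upwards [h1.eventually_lt_const (half_pos hε),
    hab.eventually_lt_const (pow_pos (half_pos hε) 2)] with n hn1 hn2 x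
  have hn0 := pnat_pos n
  have hn1' : (1 : ℝ) ≤ n := by exact_mod_cast n.pos
  set r := (n : ℝ) ^ (-((d : ℝ) / α)) with hr
  have hr0 : 0 < r := Real.rpow_pos_of_pos hn0 _
  -- `n^{-2d/α} ≤ n^{-d}` as `α ≤ 2`, so each single squared deviation is bounded by the mean
  -- square.
  have hr2 : r ^ 2 ≤ 1 / (n : ℝ) ^ d := by
    have e : 1 / (n : ℝ) ^ d = (n : ℝ) ^ (-(d : ℝ)) := by
      rw [Real.rpow_neg hn0.le, Real.rpow_natCast, one_div]
    rw [e, hr, ← Real.rpow_natCast, ← Real.rpow_mul hn0.le]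
    refine Real.rpow_le_rpow_of_exponent_le hn1' ?_
    have : (d : ℝ) ≤ d / α * 2 := by
      rw [div_mul_eq_mul_div, le_div_iff₀ hα]; nlinarith
    push_cast
    linarith
  have h2 : (r * (a n x - b n x)) ^ 2 < (ε / 2) ^ 2 := by
    refine lt_of_le_of_lt ?_ hn2
    rw [mul_pow]
    exact mul_le_mul hr2 (Finset.single_le_sum (f := fun x => (a n x - b n x) ^ 2)
      (fun _ _ => sq_nonneg _) (Finset.mem_univ x)) (sq_nonneg _) (by positivity)
  have h3 := abs_lt_of_sq_lt_sq h2 (half_pos hε).le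
  have h4 : |r * b n x| ≤ ε / 2 := by
    rw [abs_mul, abs_of_pos hr0]
    exact (mul_le_mul_of_nonneg_left (hb n x) hr0.le).trans hn1.le
  calc |r * a n x| = |r * (a n x - b n x) + r * b n x| := by congr 1; ring
    _ ≤ _ := (abs_add_le _ _).trans (by linarith)

end Powers

/-- The sandpile pairing as a weighted sum, with the asymptotics of the weights. -/
lemma exists_weights {d : ℕ} (hd : 1 ≤ d) {α : ℝ} (hα : 0 < α) (hα2 : α ≤ 2) (f : SmoothFun d)
    (hf : ∫ x, f.1 x = 0) :
    ∃ k : (n : ℕ+) → Site d n → ℝ,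
      (∀ n σ, scaling d α n * fieldPair (initialConfig σ) f = ∑ x, k n x * σ x) ∧
      (∀ ε > 0, ∀ᶠ n in atTop, ∀ x, |k n x| ≤ ε) ∧
      Tendsto (fun n => ∑ x, |k n x| ^ α) atTop (𝓝 (∫ x, |potential f x| ^ α)) := by
  choose H h0 hH using exists_kernel hd f hf
  have hab : Tendsto (fun n : ℕ+ => (1 / (n : ℝ) ^ d) *
      ∑ x, (H n x - potential f (-sitePt x)) ^ 2) atTop (𝓝 0) := by
    refine squeeze_zero (fun n => by have := pnat_pos n; positivity)
      (fun n => sum_sq_kernel_sub_le hd f hf (h0 n) (hH n)) ?_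
    have h1 := ((((tendsto_cellError f).const_mul (4 * Real.pi ^ 2)).add
      (tendsto_poissonError f)).pow 2).const_mul ((d : ℝ) ^ 2)
    have h2 := (h1.div_const 2).add (((tendsto_potentialMean f).pow 2).const_mul 2)
    simpa using h2
  obtain ⟨M, hM⟩ := isCompact_univ.exists_bound_of_continuousOn
    (continuous_potential f).continuousOn
  have hb : ∀ (n : ℕ+) (x : Site d n), |potential f (-sitePt x)| ≤ M :=
    fun n x => hM _ (Set.mem_univ _)
  refine ⟨fun n x => (n : ℝ) ^ (-((d : ℝ) / α)) * H n x,
    fun n σ => scaling_mul_fieldPair hd α f (h0 n) (hH n) σ,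
    fun ε hε => eventually_abs_rpow_mul_le hd hα hα2 hb hab hε, ?_⟩
  have hI : Tendsto (fun n : ℕ+ => (1 / (n : ℝ) ^ d) *
      ∑ x : Site d n, |potential f (-sitePt x)| ^ α) atTop (𝓝 (∫ x, |potential f x| ^ α)) := by
    refine (tendsto_riemann_sum (φ := fun x => |potential f x| ^ α)
      ((continuous_potential f).abs.rpow_const fun _ => Or.inr hα.le)).congr fun n => ?_
    rw [← sum_neg_sitePt fun x => |potential f x| ^ α]
  refine (tendsto_mean_abs_rpow hα hα2 hb hab hI).congr fun n => ?_
  have hn := pnat_pos n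
  rw [Finset.mul_sum]
  refine Finset.sum_congr rfl fun x _ => ?_
  rw [abs_mul, Real.mul_rpow (abs_nonneg _) (abs_nonneg _),
    abs_of_pos (Real.rpow_pos_of_pos hn _), ← Real.rpow_mul hn.le]
  congr 1
  rw [neg_mul, div_mul_cancel₀ _ hα.ne', Real.rpow_neg hn.le, Real.rpow_natCast, one_div]

/-! ### Characteristic functions -/

section CharFun

/-- The characteristic function is jointly continuous in the law and the frequency. -/
lemma tendsto_charFun_of_tendsto {ι : Type*} {l : Filter ι} {ν : ι → ProbabilityMeasure ℝ}
    {ν₀ : ProbabilityMeasure ℝ} {θ : ι → ℝ} {θ₀ : ℝ} (hν : Tendsto ν l (𝓝 ν₀))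
    (hθ : Tendsto θ l (𝓝 θ₀)) :
    Tendsto (fun i => charFun (ν i : Measure ℝ) (θ i)) l (𝓝 (charFun (ν₀ : Measure ℝ) θ₀)) := by
  have hc : Continuous fun p : ℝ × ℝ => Complex.exp (p.2 * p.1 * Complex.I) := by fun_prop
  have hb : ∀ p : ℝ × ℝ, ‖Complex.exp (p.2 * p.1 * Complex.I)‖ ≤ 1 := fun p => by
    rw [← Complex.ofReal_mul, Complex.norm_exp_ofReal_mul_I]
  -- With the frequency encoded as a Dirac mass, joint continuity becomes weak continuity of the
  -- product of measures.
  have key : ∀ (ν : ProbabilityMeasure ℝ) (t : ℝ), charFun (ν : Measure ℝ) t =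
      ∫ p, Complex.exp (p.2 * p.1 * Complex.I) ∂((ν.prod (diracProba t) :
        ProbabilityMeasure (ℝ × ℝ)) : Measure (ℝ × ℝ)) := by
    intro ν t
    change _ = ∫ p, Complex.exp (p.2 * p.1 * Complex.I) ∂((ν : Measure ℝ).prod (Measure.dirac t))
    rw [integral_prod, charFun_apply_real]
    · simp
    · exact Integrable.of_bound hc.aestronglyMeasurable 1 (ae_of_all _ hb)
  simp only [key]
  have h : Tendsto (fun i => (ν i).prod (diracProba (θ i))) l (𝓝 (ν₀.prod (diracProba θ₀))) :=
    (ProbabilityMeasure.continuous_prod.tendsto (ν₀, diracProba θ₀)).comp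
      (hν.prodMk_nhds ((continuous_diracProba.tendsto θ₀).comp hθ))
  exact (ProbabilityMeasure.tendsto_iff_forall_integral_rclike_tendsto ℂ).mp h
    (BoundedContinuousFunction.ofNormedAddCommGroup _ hc 1 hb)

/-- The characteristic function of a linear combination of independent variables. -/
lemma integral_exp_pi {ι : Type*} [Fintype ι] (μ : Measure ℝ) [IsProbabilityMeasure μ]
    (k : ι → ℝ) :
    ∫ w, Complex.exp (Complex.I * ((∑ i, k i * w i : ℝ) : ℂ)) ∂(Measure.pi fun _ : ι => μ) =
      ∏ i, charFun μ (k i) := by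
  simp only [charFun_apply_real]
  rw [← integral_fintype_prod_eq_prod (fun i (x : ℝ) => Complex.exp (k i * x * Complex.I))]
  refine integral_congr_ae (ae_of_all _ fun w => ?_)
  simp only
  rw [← Complex.exp_sum]
  congr 1
  push_cast
  rw [Finset.mul_sum]
  exact Finset.sum_congr rfl fun i _ => by ring

lemma charFun_map_sum_pi (μ : Measure ℝ) [IsProbabilityMeasure μ] (N : ℕ) (a t : ℝ) :
    charFun ((Measure.pi fun _ : Fin N => μ).map fun w => a * ∑ i, w i) t =
      charFun μ (a * t) ^ N := by
  rw [charFun_apply_real, integral_map (by fun_prop) (by fun_prop)]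
  have := integral_exp_pi μ (fun _ : Fin N => a * t)
  rw [Finset.prod_const, Finset.card_univ, Fintype.card_fin] at this
  rw [← this]
  refine integral_congr_ae (ae_of_all _ fun w => ?_)
  simp only
  congr 1
  rw [← Finset.mul_sum]
  push_cast
  ring

lemma charFun_eq_re {μ : Measure ℝ} (h : μ.map (fun w => -w) = μ) (t : ℝ) :
    charFun μ t = ((charFun μ t).re : ℂ) := by
  have h1 : charFun μ (-t) = charFun μ t := by
    have := charFun_map_mul (μ := μ) (-1) t
    simp only [neg_one_mul] at this
    rw [← this, h]
  rw [charFun_neg] at h1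
  exact (Complex.conj_eq_iff_re.mp h1).symm

/-- The characteristic exponent of `μ`. -/
def charExponent (μ : Measure ℝ) (t : ℝ) : ℝ := -Real.log (charFun μ t).re

lemma charExponent_neg (μ : Measure ℝ) (t : ℝ) : charExponent μ (-t) = charExponent μ t := by
  rw [charExponent, charFun_neg, Complex.conj_re, charExponent]

lemma eventually_charFun_eq_exp {μ : Measure ℝ} [IsProbabilityMeasure μ]
    (h : μ.map (fun w => -w) = μ) :
    ∀ᶠ t in 𝓝 (0 : ℝ), charFun μ t = (Real.exp (-charExponent μ t) : ℂ) := by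
  have hc : ContinuousAt (fun t => (charFun μ t).re) 0 :=
    (Complex.continuous_re.comp continuous_charFun).continuousAt
  have h1 : ∀ᶠ t in 𝓝 (0 : ℝ), 0 < (charFun μ t).re :=
    hc.eventually_const_lt (by simp)
  filter_upwards [h1] with t ht
  rw [charExponent, neg_neg, Real.exp_log ht]
  exact charFun_eq_re h t

/-- With `N = ⌊t^{-α}⌋`, `charFun μ t ^ N` is the characteristic function of the normalised sum at
`t N^{1/α} → 1`. Joint continuity gives the limit `exp(-c^α)`; taking logarithms and dividing by `N
t^α → 1` gives the claim for a continuous parameter `t`. -/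
lemma tendsto_charExponent_div {α c : ℝ} (hα : 0 < α) {μ : Measure ℝ} [IsProbabilityMeasure μ]
    (hμ : InDomainOfNormalAttraction α c μ) :
    Tendsto (fun t => charExponent μ t / t ^ α) (𝓝[>] 0) (𝓝 (c ^ α)) := by
  obtain ⟨hsymm, ρ, hρ, hstab, hconv⟩ := hμ
  have hX : Tendsto (fun t : ℝ => t ^ (-α)) (𝓝[>] 0) atTop :=
    tendsto_rpow_neg_nhdsGT_zero (by linarith)
  set N : ℝ → ℕ := fun t => ⌊t ^ (-α)⌋₊ with hN
  have hN1 : Tendsto N (𝓝[>] 0) atTop := tendsto_nat_floor_atTop.comp hX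
  have hratio : Tendsto (fun t => (N t : ℝ) * t ^ α) (𝓝[>] 0) (𝓝 1) := by
    refine (tendsto_nat_floor_div_atTop.comp hX).congr' ?_
    filter_upwards [self_mem_nhdsWithin] with t ht
    have ht' : 0 < t := ht
    simp only [Function.comp, hN]
    rw [Real.rpow_neg ht'.le, div_inv_eq_mul]
  have hθ : Tendsto (fun t => t * (N t : ℝ) ^ (1 / α)) (𝓝[>] 0) (𝓝 1) := by
    have := hratio.rpow_const (p := 1 / α) (Or.inl one_ne_zero)
    rw [Real.one_rpow] at this
    refine this.congr' ?_
    filter_upwards [self_mem_nhdsWithin] with t ht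
    have ht' : 0 < t := ht
    rw [Real.mul_rpow (by positivity) (by positivity), ← Real.rpow_mul ht'.le,
      mul_one_div_cancel hα.ne', Real.rpow_one, mul_comm]
  have hlim := tendsto_charFun_of_tendsto (hconv.tendsto.comp hN1) hθ
  have hρ1 : charFun (ρ.map id) 1 = (Real.exp (-c ^ α) : ℂ) := by
    rw [Measure.map_id, hstab]; simp
  have hpow : Tendsto (fun t => charFun μ t ^ N t) (𝓝[>] 0) (𝓝 (Real.exp (-c ^ α) : ℂ)) := by
    rw [← hρ1]
    refine hlim.congr' ?_
    filter_upwards [self_mem_nhdsWithin, hN1.eventually_gt_atTop 0] with t ht hNt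
    have ht' : (0 : ℝ) < N t := by exact_mod_cast hNt
    simp only [Function.comp, ProbabilityMeasure.coe_mk]
    rw [charFun_map_sum_pi]
    congr 2
    rw [mul_comm t, ← mul_assoc, ← Real.rpow_add ht']
    simp
  have hre : Tendsto (fun t => Real.exp (-(N t * charExponent μ t))) (𝓝[>] 0)
      (𝓝 (Real.exp (-c ^ α))) := by
    have h1 := (Complex.continuous_re.tendsto _).comp hpow
    rw [Complex.ofReal_re] at h1
    refine h1.congr' ?_
    filter_upwards [(eventually_charFun_eq_exp hsymm).filter_mono nhdsWithin_le_nhds] with t ht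
    simp only [Function.comp]
    rw [ht, ← Complex.ofReal_pow, Complex.ofReal_re, ← Real.exp_nat_mul]
    congr 1; ring
  have hexp : Tendsto (fun t => N t * charExponent μ t) (𝓝[>] 0) (𝓝 (c ^ α)) := by
    have h1 := (Real.continuousAt_log (Real.exp_pos (-c ^ α)).ne').tendsto.comp hre
    simp only [Function.comp_def, Real.log_exp] at h1
    simpa using h1.neg
  have h2 := hexp.div hratio one_ne_zero
  rw [div_one] at h2
  refine h2.congr' ?_
  filter_upwards [self_mem_nhdsWithin, hN1.eventually_gt_atTop 0] with t ht hNt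
  have ht' : 0 < t ^ α := Real.rpow_pos_of_pos ht _
  have : (0 : ℝ) < N t := by exact_mod_cast hNt
  simp only [Pi.div_apply]
  field_simp

/-- The asymptotics at the origin of the characteristic function of a law in the domain of normal
attraction of a stable law. -/
lemma exists_charFun_eq_exp {α c : ℝ} (hα : 0 < α) {μ : Measure ℝ} [IsProbabilityMeasure μ]
    (hμ : InDomainOfNormalAttraction α c μ) {ε : ℝ} (hε : 0 < ε) :
    ∃ δ > 0, ∀ t, |t| ≤ δ → charFun μ t = (Real.exp (-charExponent μ t) : ℂ) ∧
      |charExponent μ t - c ^ α * |t| ^ α| ≤ ε * |t| ^ α := by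
  have h1 := Metric.tendsto_nhds.mp (tendsto_charExponent_div hα hμ) ε hε
  rw [eventually_nhdsWithin_iff] at h1
  obtain ⟨δ, hδ, h⟩ := Metric.eventually_nhds_iff.mp (h1.and (eventually_charFun_eq_exp hμ.1))
  refine ⟨δ / 2, half_pos hδ, fun t ht => ?_⟩
  have hlt : |t| < δ := ht.trans_lt (half_lt_self hδ)
  refine ⟨(h (y := t) (by simpa using hlt)).2, ?_⟩
  rcases (abs_nonneg t).eq_or_lt with h0 | h0
  · rw [← h0, Real.zero_rpow hα.ne']
    have : t = 0 := abs_eq_zero.mp h0.symm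
    simp [this, charExponent]
  · have h2 := (h (y := |t|) (by simpa using hlt)).1 h0
    have e : charExponent μ |t| = charExponent μ t := by
      rcases abs_choice t with h' | h' <;> rw [h']
      exact charExponent_neg μ t
    have hp : 0 < |t| ^ α := Real.rpow_pos_of_pos h0 _
    rw [Real.dist_eq, e] at h2
    have h3 : charExponent μ t - c ^ α * |t| ^ α =
        (charExponent μ t / |t| ^ α - c ^ α) * |t| ^ α := by field_simp
    rw [h3, abs_mul, abs_of_pos hp]
    exact mul_le_mul_of_nonneg_right h2.le hp.le

/-- Uniformly small weights put every factor in the range of the expansion at `0`; the errors add up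
to at most `ε ∑ |k|^α`, with a bounded sum. -/
lemma tendsto_prod_charFun {d : ℕ} {α c : ℝ} (hα : 0 < α) {μ : Measure ℝ}
    [IsProbabilityMeasure μ] (hμ : InDomainOfNormalAttraction α c μ) {k : (n : ℕ+) → Site d n → ℝ}
    {I : ℝ} (hk : ∀ ε > 0, ∀ᶠ n in atTop, ∀ x, |k n x| ≤ ε)
    (hI : Tendsto (fun n => ∑ x, |k n x| ^ α) atTop (𝓝 I)) :
    Tendsto (fun n => ∏ x, charFun μ (k n x)) atTop (𝓝 (Real.exp (-(c ^ α * I)) : ℂ)) := by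
  have hψ : Tendsto (fun n => ∑ x, charExponent μ (k n x)) atTop (𝓝 (c ^ α * I)) := by
    suffices h : Tendsto (fun n => ∑ x, charExponent μ (k n x) - c ^ α * ∑ x, |k n x| ^ α) atTop
        (𝓝 0) by simpa using h.add (hI.const_mul (c ^ α))
    rw [Metric.tendsto_nhds]
    intro ε hε
    have hI0 : 0 ≤ I := ge_of_tendsto' hI fun n => Finset.sum_nonneg fun x _ => by positivity
    obtain ⟨δ, hδ, h⟩ := exists_charFun_eq_exp hα hμ (ε := ε / (I + 1)) (by positivity)
    filter_upwards [hk δ hδ, hI.eventually_lt_const (lt_add_one I)] with n hn hn2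
    rw [Real.dist_eq, sub_zero, Finset.mul_sum, ← Finset.sum_sub_distrib]
    calc _ ≤ ∑ x, ε / (I + 1) * |k n x| ^ α := (Finset.abs_sum_le_sum_abs _ _).trans
          (Finset.sum_le_sum fun x _ => (h _ (hn x)).2)
      _ = ε / (I + 1) * ∑ x, |k n x| ^ α := by rw [Finset.mul_sum]
      _ < ε / (I + 1) * (I + 1) := by gcongr
      _ = ε := by field_simp
  have h2 : Tendsto (fun n => (Real.exp (-∑ x, charExponent μ (k n x)) : ℂ)) atTop
      (𝓝 (Real.exp (-(c ^ α * I)) : ℂ)) :=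
    (Complex.continuous_ofReal.tendsto _).comp ((Real.continuous_exp.tendsto _).comp hψ.neg)
  refine h2.congr' ?_
  obtain ⟨δ, hδ, h⟩ := exists_charFun_eq_exp hα hμ one_pos
  filter_upwards [hk δ hδ] with n hn
  rw [Finset.prod_congr rfl fun x _ => (h _ (hn x)).1, ← Complex.ofReal_prod, ← Real.exp_sum,
    Finset.sum_neg_distrib]

/-- The characteristic function of a weighted sum of i.i.d. variables. -/
lemma integral_exp_of_iIndepFun {ι Ω : Type*} [Fintype ι] [MeasurableSpace Ω] {P : Measure Ω}
    [IsProbabilityMeasure P] {μ : Measure ℝ} [IsProbabilityMeasure μ] {X : ι → Ω → ℝ}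
    (hlaw : ∀ i, HasLaw (X i) μ P) (hind : iIndepFun X P) (k : ι → ℝ) :
    ∫ ω, Complex.exp (Complex.I * ((∑ i, k i * X i ω : ℝ) : ℂ)) ∂P = ∏ i, charFun μ (k i) := by
  have hm := fun i => (hlaw i).aemeasurable
  have h := (iIndepFun_iff_map_fun_eq_pi_map hm).mp hind
  simp only [(hlaw _).map_eq] at h
  rw [← integral_exp_pi, ← h, integral_map (aemeasurable_pi_lambda _ hm)]
  exact (Continuous.measurable (by fun_prop)).aestronglyMeasurable

end CharFun

/-! ### A stable law on the space of Fourier coefficients -/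

section StableCoefficients

variable {d : ℕ}

/-- The nonzero frequencies. -/
abbrev Freq (d : ℕ) : Type := {z : Fin d → ℤ // z ≠ 0}

/-- The tail is controlled by the mean of `1 - charFun` over `[-2/r, 2/r]`, where the hypothesis
gives at most `A (2/r)^α`. -/
lemma measureReal_abs_gt_le_of_charFun {α A : ℝ} (hα : 0 < α) (hA : 0 ≤ A) {μ : Measure ℝ}
    [IsProbabilityMeasure μ] (h : ∀ t, ‖1 - charFun μ t‖ ≤ A * |t| ^ α) {r : ℝ} (hr : 0 < r) :
    μ.real {x | r < |x|} ≤ 2 * A * (2 / r) ^ α := by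
  refine (measureReal_abs_gt_le_integral_charFun hr).trans ?_
  have hb : ‖∫ t in (-2 * r⁻¹)..(2 * r⁻¹), 1 - charFun μ t‖ ≤
      A * (2 / r) ^ α * |2 * r⁻¹ - -2 * r⁻¹| := by
    refine intervalIntegral.norm_integral_le_of_norm_le_const fun t ht => (h t).trans ?_
    have h0 : 0 < r⁻¹ := inv_pos.mpr hr
    rw [Set.uIoc_of_le (by linarith)] at ht
    refine mul_le_mul_of_nonneg_left (Real.rpow_le_rpow (abs_nonneg _) ?_ hα.le) hA
    rw [div_eq_mul_inv, abs_le]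
    constructor <;> linarith [ht.1, ht.2]
  have e : |2 * r⁻¹ - -2 * r⁻¹| = 4 * r⁻¹ := by
    rw [abs_of_nonneg] <;> [ring; (have := inv_pos.mpr hr; linarith)]
  rw [e] at hb
  calc _ ≤ 2⁻¹ * r * (A * (2 / r) ^ α * (4 * r⁻¹)) := by gcongr
    _ = _ := by field_simp; ring

/-- The bound `(1 + ‖z‖)^p` on the coefficients. -/
def growth (p : ℕ) (z : Freq d) : ℝ := (1 + ‖z.1‖) ^ p

lemma growth_pos (p : ℕ) (z : Freq d) : 0 < growth p z := by unfold growth; positivity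

/-- The coefficients of growth at most `R (1 + ‖z‖)^p`. -/
def growthSet (d p : ℕ) (R : ℝ) : Set (Freq d → ℂ) :=
  {b | ∀ z, |(b z).re| ≤ R * growth p z ∧ |(b z).im| ≤ R * growth p z}

/-- A product of compact rectangles, by Tychonoff. -/
lemma isCompact_growthSet (p : ℕ) (R : ℝ) : IsCompact (growthSet d p R) := by
  have : growthSet d p R = Set.pi Set.univ fun z : Freq d =>
      (Set.Icc (-(R * growth p z)) (R * growth p z)) ×ℂ
        (Set.Icc (-(R * growth p z)) (R * growth p z)) := by
    ext b
    simp only [growthSet, Set.mem_ofPred_eq, Set.mem_pi, Set.mem_univ, true_imp_iff,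
      Complex.mem_reProdIm, Set.mem_Icc, abs_le]
  rw [this]
  exact isCompact_univ_pi fun z => isCompact_Icc.reProdIm isCompact_Icc

lemma summable_growth {α : ℝ} {p : ℕ} (hp : (d : ℝ) + 1 ≤ p * α) :
    Summable fun z : Freq d => growth p z ^ (-α) := by
  refine Summable.of_nonneg_of_le (fun z => Real.rpow_nonneg (growth_pos p z).le _) (fun z => ?_)
    ((summable_norm_inv_pow (Nat.lt_succ_self d)).subtype {z | z ≠ 0})
  have hz : 0 < ‖z.1‖ := norm_pos_iff.mpr z.2
  have h1 : 1 ≤ 1 + ‖z.1‖ := by linarith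
  simp only [Function.comp, growth]
  rw [← Real.rpow_natCast, ← Real.rpow_mul (by linarith)]
  calc (1 + ‖z.1‖) ^ ((p : ℝ) * -α) ≤ (1 + ‖z.1‖) ^ (-((d + 1 : ℕ) : ℝ)) :=
        Real.rpow_le_rpow_of_exponent_le h1 (by push_cast; linarith)
    _ = (1 + ‖z.1‖)⁻¹ ^ (d + 1) := by
        rw [Real.rpow_neg (by linarith), Real.rpow_natCast, inv_pow]
    _ ≤ ‖z.1‖⁻¹ ^ (d + 1) := by gcongr; linarith

/-- Uniform control of the growth of the coefficients by the one-dimensional characteristic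
functions. -/
lemma measure_compl_growthSet_le {α A : ℝ} (hα : 0 < α) (hA : 0 ≤ A) {p : ℕ}
    (hp : (d : ℝ) + 1 ≤ p * α) {ν : Measure (Freq d → ℂ)} [IsProbabilityMeasure ν]
    (h : ∀ (z : Freq d) (w : ℂ),
      ‖1 - ∫ b, Complex.exp (Complex.I * ((w * b z).re : ℂ)) ∂ν‖ ≤ A * ‖w‖ ^ α)
    {R : ℝ} (hR : 0 < R) :
    ν (growthSet d p R)ᶜ ≤ ENNReal.ofReal
      (4 * A * (2 / R) ^ α * ∑' z : Freq d, growth p z ^ (-α)) := by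
  -- To be used with `w = 1` for the real part and `w = -i` for the imaginary part, whence the final
  -- constant `4A`.
  have htail : ∀ (z : Freq d) (w : ℂ), ‖w‖ = 1 →
      ν {b | R * growth p z < |(w * b z).re|} ≤
        ENNReal.ofReal (2 * A * (2 / R) ^ α * growth p z ^ (-α)) := by
    intro z w hw
    have hg := growth_pos p z
    have hm : Measurable fun b : Freq d → ℂ => (w * b z).re := by fun_prop
    have hprob : IsProbabilityMeasure (ν.map fun b => (w * b z).re) :=
      Measure.isProbabilityMeasure_map hm.aemeasurable
    have h1 : ∀ t, ‖1 - charFun (ν.map fun b => (w * b z).re) t‖ ≤ A * |t| ^ α := by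
      intro t
      rw [charFun_apply_real, integral_map hm.aemeasurable (by fun_prop)]
      have h2 := h z (t * w)
      rw [norm_mul, hw, mul_one, Complex.norm_real, Real.norm_eq_abs] at h2
      refine le_of_eq_of_le ?_ h2
      congr 2
      refine integral_congr_ae (ae_of_all _ fun b => ?_)
      simp only
      congr 1
      rw [mul_assoc (t : ℂ) w, Complex.re_ofReal_mul]
      push_cast
      ring
    have h3 := measureReal_abs_gt_le_of_charFun hα hA h1 (mul_pos hR hg)
    rw [map_measureReal_apply hm (measurableSet_lt measurable_const (by fun_prop))] at h3
    rw [← ENNReal.ofReal_toReal (measure_ne_top ν _)]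
    refine ENNReal.ofReal_le_ofReal (h3.trans (le_of_eq ?_))
    rw [← div_div, Real.div_rpow (by positivity) hg.le, Real.rpow_neg hg.le]
    field_simp
  have hsub : (growthSet d p R)ᶜ ⊆ ⋃ z : Freq d,
      ({b | R * growth p z < |(1 * b z).re|} ∪ {b | R * growth p z < |(-Complex.I * b z).re|}) := by
    intro b hb
    simp only [growthSet, Set.mem_compl_iff, Set.mem_ofPred_eq, not_forall] at hb
    obtain ⟨z, hz⟩ := hb
    rw [Set.mem_iUnion]
    refine ⟨z, ?_⟩
    rw [not_and_or, not_le, not_le] at hz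
    simpa using! hz
  have hS := summable_growth hp
  calc ν (growthSet d p R)ᶜ ≤ ∑' z : Freq d, ν ({b | R * growth p z < |(1 * b z).re|} ∪
        {b | R * growth p z < |(-Complex.I * b z).re|}) :=
        (measure_mono hsub).trans (measure_iUnion_le _)
    _ ≤ ∑' z : Freq d, ENNReal.ofReal (4 * A * (2 / R) ^ α * growth p z ^ (-α)) := by
        refine ENNReal.tsum_le_tsum fun z => ?_
        refine (measure_union_le _ _).trans
          ((add_le_add (htail z 1 (by simp)) (htail z (-Complex.I) (by simp))).trans ?_)
        have := growth_pos p z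
        rw [← ENNReal.ofReal_add (by positivity) (by positivity)]
        exact ENNReal.ofReal_le_ofReal (le_of_eq (by ring))
    _ = _ := by
        rw [← ENNReal.ofReal_tsum_of_nonneg _ (hS.mul_left _), tsum_mul_left]
        intro z
        have := growth_pos p z
        positivity

lemma tendsto_const_mul_two_div_rpow {α : ℝ} (hα : 0 < α) (C D : ℝ) :
    Tendsto (fun R : ℕ => ENNReal.ofReal (C * (2 / (R : ℝ)) ^ α * D)) atTop (𝓝 0) := by
  have h1 : Tendsto (fun R : ℕ => (2 : ℝ) / (R : ℝ)) atTop (𝓝 0) :=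
    tendsto_const_nhds.div_atTop tendsto_natCast_atTop_atTop
  have h2 := h1.rpow_const (p := α) (Or.inr hα.le)
  rw [Real.zero_rpow hα.ne'] at h2
  have h3 := ENNReal.tendsto_ofReal ((h2.const_mul C).mul_const D)
  simpa using h3

/-- A trigonometric polynomial. -/
def trigPoly (S : Finset (Freq d)) (w : Freq d → ℂ) (x : UnitAddTorus (Fin d)) : ℝ :=
  (∑ z ∈ S, w z * UnitAddTorus.mFourier (-z.1) x).re

lemma continuous_trigPoly (S : Finset (Freq d)) (w : Freq d → ℂ) : Continuous (trigPoly S w) :=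
  Complex.continuous_re.comp (continuous_finsetSum _ fun _ _ =>
    continuous_const.mul (ContinuousMap.continuous _))

/-- The Fourier coefficients of the normalised sum of point masses with weights `ζ`. -/
def noiseCoef (α : ℝ) {n : ℕ+} (ζ : Site d n → ℝ) (z : Freq d) : ℂ :=
  ∑ x, (((n : ℝ) ^ (-((d : ℝ) / α)) * ζ x : ℝ) : ℂ) * UnitAddTorus.mFourier (-z.1) (sitePt x)

lemma measurable_noiseCoef (α : ℝ) (n : ℕ+) : Measurable (noiseCoef (d := d) α (n := n)) := by
  unfold noiseCoef
  fun_prop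

lemma re_sum_mul_noiseCoef (α : ℝ) {n : ℕ+} (ζ : Site d n → ℝ) (S : Finset (Freq d))
    (w : Freq d → ℂ) : (∑ z ∈ S, w z * noiseCoef α ζ z).re =
      ∑ x, (n : ℝ) ^ (-((d : ℝ) / α)) * trigPoly S w (sitePt x) * ζ x := by
  have : ∑ z ∈ S, w z * noiseCoef α ζ z = ∑ x, (((n : ℝ) ^ (-((d : ℝ) / α)) * ζ x : ℝ) : ℂ) *
      ∑ z ∈ S, w z * UnitAddTorus.mFourier (-z.1) (sitePt x) := by
    simp only [noiseCoef, Finset.mul_sum]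
    rw [Finset.sum_comm]
    exact Finset.sum_congr rfl fun x _ => Finset.sum_congr rfl fun z _ => by ring
  rw [this, Complex.re_sum]
  refine Finset.sum_congr rfl fun x _ => ?_
  rw [Complex.re_ofReal_mul, trigPoly]
  ring

/-- The law of `noiseCoef` for i.i.d. weights of law `ρ`. -/
def noiseLaw (d : ℕ) (α : ℝ) (ρ : Measure ℝ) (n : ℕ+) : Measure (Freq d → ℂ) :=
  (Measure.pi fun _ : Site d n => ρ).map (noiseCoef α)

instance (α : ℝ) (ρ : Measure ℝ) [IsProbabilityMeasure ρ] (n : ℕ+) :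
    IsProbabilityMeasure (noiseLaw d α ρ n) :=
  Measure.isProbabilityMeasure_map (measurable_noiseCoef α n).aemeasurable

lemma continuous_exp_re_sum (S : Finset (Freq d)) (w : Freq d → ℂ) :
    Continuous fun b : Freq d → ℂ => Complex.exp (Complex.I * ((∑ z ∈ S, w z * b z).re : ℂ)) := by
  fun_prop

lemma norm_exp_I_mul_ofReal (r : ℝ) : ‖Complex.exp (Complex.I * (r : ℂ))‖ = 1 := by
  rw [mul_comm, Complex.norm_exp_ofReal_mul_I]

lemma integral_exp_noiseLaw {α c : ℝ} (hα : 0 < α) {ρ : Measure ℝ} [IsProbabilityMeasure ρ]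
    (hρ : IsSymmStable α c ρ) (n : ℕ+) (S : Finset (Freq d)) (w : Freq d → ℂ) :
    ∫ b, Complex.exp (Complex.I * ((∑ z ∈ S, w z * b z).re : ℂ)) ∂(noiseLaw d α ρ n) =
      (Real.exp (-(c ^ α * ((1 / (n : ℝ) ^ d) * ∑ x : Site d n,
        |trigPoly S w (sitePt x)| ^ α))) : ℂ) := by
  have hn := pnat_pos n
  rw [noiseLaw, integral_map (measurable_noiseCoef α n).aemeasurable
    (continuous_exp_re_sum S w).aestronglyMeasurable]
  simp only [re_sum_mul_noiseCoef]
  rw [integral_exp_pi]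
  simp only [hρ _]
  rw [← Complex.ofReal_prod, ← Real.exp_sum, Finset.sum_neg_distrib, ← Finset.mul_sum]
  congr 5
  rw [Finset.mul_sum]
  refine Finset.sum_congr rfl fun x _ => ?_
  rw [abs_mul, Real.mul_rpow (abs_nonneg _) (abs_nonneg _),
    abs_of_pos (Real.rpow_pos_of_pos hn _), ← Real.rpow_mul hn.le, neg_mul,
    div_mul_cancel₀ _ hα.ne', Real.rpow_neg hn.le, Real.rpow_natCast, one_div]

lemma abs_trigPoly_singleton_le (z : Freq d) (w : Freq d → ℂ) (x : UnitAddTorus (Fin d)) :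
    |trigPoly {z} w x| ≤ ‖w z‖ := by
  rw [trigPoly, Finset.sum_singleton]
  refine (Complex.abs_re_le_norm _).trans ?_
  rw [norm_mul, norm_mFourier_apply, mul_one]

lemma norm_one_sub_exp_neg_le {h : ℝ} (h0 : 0 ≤ h) : ‖1 - (Real.exp (-h) : ℂ)‖ ≤ h := by
  rw [← Complex.ofReal_one, ← Complex.ofReal_sub, Complex.norm_real, Real.norm_eq_abs,
    abs_of_nonneg (by simpa using h0)]
  linarith [Real.add_one_le_exp (-h)]

lemma norm_one_sub_integral_noiseLaw_le {α c : ℝ} (hα : 0 < α) (hc : 0 < c) {ρ : Measure ℝ}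
    [IsProbabilityMeasure ρ] (hρ : IsSymmStable α c ρ) (n : ℕ+) (z : Freq d) (w : ℂ) :
    ‖1 - ∫ b, Complex.exp (Complex.I * ((w * b z).re : ℂ)) ∂(noiseLaw d α ρ n)‖ ≤
      c ^ α * ‖w‖ ^ α := by
  have hn := pnat_pos n
  have h := integral_exp_noiseLaw hα hρ n {z} (fun _ => w)
  simp only [Finset.sum_singleton] at h
  rw [h]
  refine (norm_one_sub_exp_neg_le (by positivity)).trans ?_
  refine mul_le_mul_of_nonneg_left ?_ (by positivity)
  calc _ ≤ 1 / (n : ℝ) ^ d * ∑ x : Site d n, ‖w‖ ^ α := by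
        gcongr with x
        exact abs_trigPoly_singleton_le z (fun _ => w) (sitePt x)
    _ = ‖w‖ ^ α := by
        rw [Finset.sum_const, Finset.card_univ, card_site, nsmul_eq_mul]
        push_cast
        field_simp

/-- There is a law on the space of Fourier coefficients with the characteristic functional of the
stable noise on the torus. -/
lemma exists_stable_law {α c : ℝ} (hα : 0 < α) (hc : 0 < c) {ρ : Measure ℝ}
    [IsProbabilityMeasure ρ] (hρ : IsSymmStable α c ρ) (d : ℕ) :
    ∃ ν : Measure (Freq d → ℂ), IsProbabilityMeasure ν ∧
      ∀ (S : Finset (Freq d)) (w : Freq d → ℂ),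
        ∫ b, Complex.exp (Complex.I * ((∑ z ∈ S, w z * b z).re : ℂ)) ∂ν =
          (Real.exp (-(c ^ α * ∫ x, |trigPoly S w x| ^ α)) : ℂ) := by
  -- The exponent making `∑ (1 + ‖z‖)^{-pα}` converge, so that the union bound over all frequencies
  -- is finite.
  obtain ⟨p, hp⟩ := exists_nat_ge (((d : ℝ) + 1) / α)
  rw [div_le_iff₀ hα] at hp
  let ν : ℕ+ → ProbabilityMeasure (Freq d → ℂ) := fun n => ⟨noiseLaw d α ρ n, inferInstance⟩
  have htight : IsTightMeasureSet {x | ∃ μ ∈ Set.range ν, (μ : Measure (Freq d → ℂ)) = x} := by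
    rw [isTightMeasureSet_iff_exists_isCompact_measure_compl_le]
    intro ε hε
    obtain ⟨R, hR, hR0⟩ := (((tendsto_const_mul_two_div_rpow hα (4 * c ^ α)
      (∑' z : Freq d, growth p z ^ (-α))).eventually_le_const hε).and
        (eventually_gt_atTop 0)).exists
    refine ⟨growthSet d p R, isCompact_growthSet p R, ?_⟩
    rintro _ ⟨_, ⟨n, rfl⟩, rfl⟩
    exact (measure_compl_growthSet_le hα (by positivity) hp
      (norm_one_sub_integral_noiseLaw_le hα hc hρ n) (by exact_mod_cast hR0)).trans hR
  have hcomp := isCompact_closure_of_isTightMeasureSet htight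
  -- A limit along an ultrafilter finer than `atTop` replaces a subsequence; the characteristic
  -- functionals converge along `atTop`, so their limit is the same.
  let U : Ultrafilter ℕ+ := Ultrafilter.of atTop
  obtain ⟨ν₀, -, hν₀⟩ := hcomp.ultrafilter_le_nhds (U.map ν) (by
    rw [le_principal_iff]
    exact Filter.mem_map.mpr (univ_mem' fun n => subset_closure ⟨n, rfl⟩))
  have hU : Tendsto ν U (𝓝 ν₀) := hν₀
  refine ⟨ν₀, inferInstance, fun S w => ?_⟩
  have h1 := (ProbabilityMeasure.tendsto_iff_forall_integral_rclike_tendsto ℂ).mp hU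
    (BoundedContinuousFunction.ofNormedAddCommGroup _ (continuous_exp_re_sum S w) 1
      fun b => (norm_exp_I_mul_ofReal _).le)
  have hφ : Continuous fun x => |trigPoly S w x| ^ α :=
    (continuous_trigPoly S w).abs.rpow_const fun _ => Or.inr hα.le
  have h2 : Tendsto (fun n => ∫ b, Complex.exp (Complex.I * ((∑ z ∈ S, w z * b z).re : ℂ))
      ∂(noiseLaw d α ρ n)) atTop (𝓝 (Real.exp (-(c ^ α * ∫ x, |trigPoly S w x| ^ α)) : ℂ)) := by
    simp only [integral_exp_noiseLaw hα hρ]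
    exact (Complex.continuous_ofReal.tendsto _).comp ((Real.continuous_exp.tendsto _).comp
      (((tendsto_riemann_sum hφ).const_mul (c ^ α)).neg))
  exact tendsto_nhds_unique h1 (h2.mono_left (Ultrafilter.of_le _))

end StableCoefficients

/-! ### The limiting random distribution -/

section RandomDistribution

variable {d : ℕ}

/-- The terms of the pairing of a distribution with Fourier coefficients `b z / ‖z‖²` and a test
function. -/
def pairTerm (b : Freq d → ℂ) (f : SmoothFun d) (z : Freq d) : ℝ :=
  (coef f z.1 / (freqSq z.1 : ℂ) * b z).re

/-- The sum of the decay of Fourier coefficients. -/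
def decaySum (d : ℕ) : ℝ := ∑' z : Freq d, ‖z.1‖⁻¹ ^ (d + 1)

lemma summable_decay (d : ℕ) : Summable fun z : Freq d => ‖z.1‖⁻¹ ^ (d + 1) :=
  (summable_norm_inv_pow (Nat.lt_succ_self d)).subtype {z | z ≠ 0}

lemma one_le_norm_freq (z : Freq d) : 1 ≤ ‖z.1‖ := by
  obtain ⟨i, hi⟩ := Function.ne_iff.mp z.2
  refine le_trans ?_ (norm_le_pi_norm z.1 i)
  rw [Int.norm_eq_abs]
  exact_mod_cast Int.one_le_abs hi

/-- Of the `p + d + 1` derivatives, `p` pay for the growth of `b` and `d + 1` for summability.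
Linearity of the bound in `B` is what makes the functional continuous. -/
lemma norm_pairTerm_le {p : ℕ} {R : ℝ} {b : Freq d → ℂ} (hb : b ∈ growthSet d p R)
    (f : SmoothFun d) {B : ℝ} (hB : ∀ w, ‖iteratedFDeriv ℝ (p + d + 1) (lift f.1) w‖ ≤ B)
    (z : Freq d) : ‖pairTerm b f z‖ ≤ R * 2 ^ (p + 1) * B * ‖z.1‖⁻¹ ^ (d + 1) := by
  have hz := one_le_norm_freq z
  have hf := one_le_freqSq z.2
  have h1 := norm_coef_le_of_iteratedFDeriv f _ hB z.1 z.2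
  have hB0 : 0 ≤ B := (norm_nonneg _).trans (hB 0)
  have h2 : ‖b z‖ ≤ 2 * (R * growth p z) :=
    (Complex.norm_le_abs_re_add_abs_im _).trans (by linarith [(hb z).1, (hb z).2])
  have hR : 0 ≤ R * growth p z := (abs_nonneg _).trans (hb z).1
  have hR0 : 0 ≤ R := nonneg_of_mul_nonneg_left hR (growth_pos p z)
  have h3 : growth p z ≤ 2 ^ p * ‖z.1‖ ^ p := by
    rw [growth, ← mul_pow]
    exact pow_le_pow_left₀ (by linarith) (by linarith) p
  have h4 : ‖coef f z.1 / (freqSq z.1 : ℂ)‖ ≤ ‖coef f z.1‖ := by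
    rw [norm_div, Complex.norm_real, Real.norm_of_nonneg (by linarith)]
    exact div_le_self (norm_nonneg _) hf
  calc ‖pairTerm b f z‖ ≤ ‖coef f z.1 / (freqSq z.1 : ℂ) * b z‖ := Complex.abs_re_le_norm _
    _ ≤ (B * ‖z.1‖⁻¹ ^ (p + d + 1)) * (2 * (R * (2 ^ p * ‖z.1‖ ^ p))) := by
        rw [norm_mul]
        refine mul_le_mul (h4.trans h1) (h2.trans ?_) (norm_nonneg _) (by positivity)
        gcongr
    _ = _ := by
        have : ‖z.1‖ ≠ 0 := by linarith
        rw [add_assoc p, pow_add ‖z.1‖⁻¹ p, inv_pow ‖z.1‖ p]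
        field_simp
        ring

lemma summable_pairTerm {p : ℕ} {R : ℝ} {b : Freq d → ℂ} (hb : b ∈ growthSet d p R)
    (f : SmoothFun d) : Summable (pairTerm b f) := by
  obtain ⟨B, hB⟩ := exists_iteratedFDeriv_le f (p + d + 1)
  exact Summable.of_norm_bounded ((summable_decay d).mul_left _) (norm_pairTerm_le hb f hB)

/-- The distribution with Fourier coefficients `b z / ‖z‖²`. -/
def distOfCoef {p : ℕ} {R : ℝ} {b : Freq d → ℂ} (hb : b ∈ growthSet d p R) :
    TorusDistribution d :=
  ⟨{ toFun := fun f => ∑' z, pairTerm b f z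
     map_add' := fun f g => by
       rw [← (summable_pairTerm hb f).tsum_add (summable_pairTerm hb g)]
       refine tsum_congr fun z => ?_
       rw [pairTerm, coef_add, add_div, add_mul, Complex.add_re]
       rfl
     map_smul' := fun a f => by
       rw [RingHom.id_apply, smul_eq_mul, ← tsum_mul_left]
       refine tsum_congr fun z => ?_
       rw [pairTerm, coef_smul, mul_div_assoc, mul_assoc, Complex.re_ofReal_mul]
       rfl },
    p + d + 1, R * 2 ^ (p + 1) * decaySum d, fun f B hB => by
      have h := tsum_of_norm_bounded ((summable_decay d).hasSum.mul_left (R * 2 ^ (p + 1) * B))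
        (norm_pairTerm_le hb f (hB _ le_rfl))
      refine (Real.norm_eq_abs _).symm.le.trans (h.trans (le_of_eq ?_))
      rw [decaySum]; ring⟩

instance : Inhabited (TorusDistribution d) := ⟨⟨0, 0, 0, fun f B _ => by simp⟩⟩

open Classical in
/-- The distribution with Fourier coefficients `b z / ‖z‖²` if these have polynomial growth, and
`0` otherwise. -/
def toDistribution (p : ℕ) (b : Freq d → ℂ) : TorusDistribution d :=
  if h : ∃ R : ℕ, b ∈ growthSet d p R then distOfCoef h.choose_spec else default

/-- The chosen `R` enters only the continuity proof, so the pairing does not depend on it. -/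
lemma pair_toDistribution {p : ℕ} {b : Freq d → ℂ} (h : ∃ R : ℕ, b ∈ growthSet d p R)
    (f : SmoothFun d) : (toDistribution p b).pair f = ∑' z, pairTerm b f z := by
  rw [toDistribution, dif_pos h]
  rfl

lemma pair_toDistribution_of_not {p : ℕ} {b : Freq d → ℂ} (h : ¬∃ R : ℕ, b ∈ growthSet d p R)
    (f : SmoothFun d) : (toDistribution p b).pair f = 0 := by
  rw [toDistribution, dif_neg h]
  rfl

lemma measurableSet_growth (d p : ℕ) :
    MeasurableSet {b : Freq d → ℂ | ∃ R : ℕ, b ∈ growthSet d p R} := by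
  have : {b : Freq d → ℂ | ∃ R : ℕ, b ∈ growthSet d p R} = ⋃ R : ℕ, growthSet d p R := by
    ext b; simp
  rw [this]
  exact MeasurableSet.iUnion fun R => (isCompact_growthSet p R).measurableSet

lemma measurable_pairTerm (f : SmoothFun d) (z : Freq d) :
    Measurable fun b : Freq d → ℂ => pairTerm b f z := by
  unfold pairTerm
  fun_prop

lemma measurable_pair_toDistribution (p : ℕ) (f : SmoothFun d) :
    Measurable fun b : Freq d → ℂ => (toDistribution p b).pair f := by
  refine measurable_of_tendsto_metrizable' (atTop : Filter (Finset (Freq d)))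
    (f := fun S => ({b | ∃ R : ℕ, b ∈ growthSet d p R} : Set (Freq d → ℂ)).indicator
      fun b => ∑ z ∈ S, pairTerm b f z) (fun S => ?_) ?_
  · exact (Finset.measurable_sum _ fun z _ => measurable_pairTerm f z).indicator
      (measurableSet_growth d p)
  · rw [tendsto_pi_nhds]
    intro b
    by_cases h : ∃ R : ℕ, b ∈ growthSet d p R
    · obtain ⟨R, hR⟩ := id h
      rw [pair_toDistribution h]
      have hs : Tendsto (fun S : Finset (Freq d) => ∑ z ∈ S, pairTerm b f z) atTop
        (𝓝 (∑' z, pairTerm b f z)) := (summable_pairTerm hR f).hasSum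
      refine hs.congr fun S => ?_
      rw [Set.indicator_of_mem]
      exact h
    · rw [pair_toDistribution_of_not h]
      refine tendsto_const_nhds.congr fun S => ?_
      rw [Set.indicator_of_notMem]
      exact h

lemma measurable_pair (f : SmoothFun d) :
    Measurable fun T : TorusDistribution d => T.pair f :=
  measurable_iff_comap_le.mpr (le_iSup (fun f : SmoothFun d =>
    MeasurableSpace.comap (fun T : TorusDistribution d => T.pair f) inferInstance) f)

lemma measurable_toDistribution (d p : ℕ) : Measurable (toDistribution (d := d) p) := by
  rw [measurable_iff_comap_le]
  unfold TorusDistribution.instMeasurableSpace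
  rw [MeasurableSpace.comap_iSup]
  refine iSup_le fun f => ?_
  rw [MeasurableSpace.comap_comp]
  exact measurable_iff_comap_le.mp (measurable_pair_toDistribution p f)

/-- There is a random distribution whose characteristic functional is that of the potential of the
stable noise. -/
lemma exists_stable_distribution {α c : ℝ} (hα : 0 < α) (hc : 0 < c) {ρ : Measure ℝ}
    [IsProbabilityMeasure ρ] (hρ : IsSymmStable α c ρ) (d : ℕ) :
    ∃ Q : Measure (TorusDistribution d), IsProbabilityMeasure Q ∧ ∀ f : SmoothFun d,
      charFunctional Q f = (Real.exp (-(c ^ α * ∫ x, |potential f x| ^ α)) : ℂ) := by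
  obtain ⟨ν, hν, hchar⟩ := exists_stable_law hα hc hρ d
  obtain ⟨p, hp⟩ := exists_nat_ge (((d : ℝ) + 1) / α)
  rw [div_le_iff₀ hα] at hp
  have hcoef : ∀ (z : Freq d) (w : ℂ),
      ‖1 - ∫ b, Complex.exp (Complex.I * ((w * b z).re : ℂ)) ∂ν‖ ≤ c ^ α * ‖w‖ ^ α := by
    intro z w
    have h := hchar {z} fun _ => w
    simp only [Finset.sum_singleton] at h
    rw [h]
    have hI : 0 ≤ ∫ x, |trigPoly {z} (fun _ => w) x| ^ α :=
      integral_nonneg fun x => by positivity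
    refine (norm_one_sub_exp_neg_le (by positivity)).trans ?_
    refine mul_le_mul_of_nonneg_left ?_ (by positivity)
    refine (integral_mono_of_nonneg (ae_of_all _ fun x => by positivity)
      (integrable_const (‖w‖ ^ α)) (ae_of_all _ fun x => ?_)).trans (by simp)
    exact Real.rpow_le_rpow (abs_nonneg _) (abs_trigPoly_singleton_le z (fun _ => w) x) hα.le
  -- The bad event lies in the complement of every growth set, whose probability tends to `0` as `R
  -- → ∞`.
  have hgood : ∀ᵐ b ∂ν, ∃ R : ℕ, b ∈ growthSet d p R := by
    rw [ae_iff]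
    refine le_antisymm (ge_of_tendsto (tendsto_const_mul_two_div_rpow hα (4 * c ^ α)
      (∑' z : Freq d, growth p z ^ (-α))) ?_) zero_le
    filter_upwards [eventually_gt_atTop 0] with R hR
    refine le_trans (measure_mono fun b hb hb' => hb ⟨R, hb'⟩) (measure_compl_growthSet_le hα
      (by positivity) hp hcoef (by exact_mod_cast hR))
  have hmeas := measurable_toDistribution d p
  refine ⟨ν.map (toDistribution p), Measure.isProbabilityMeasure_map hmeas.aemeasurable,
    fun f => ?_⟩
  have hpm := measurable_pair f
  rw [charFunctional, integral_map hmeas.aemeasurable (by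
    have : Measurable fun T : TorusDistribution d => Complex.exp (Complex.I * (T.pair f : ℂ)) := by
      fun_prop
    exact this.aestronglyMeasurable)]
  set w : Freq d → ℂ := fun z => coef f z.1 / (freqSq z.1 : ℂ) with hw
  -- The functional of `ν` is known only for finitely many frequencies; dominated convergence over
  -- finite sets `S`, on this side and for the exponent, extends it to the whole series.
  have h1 : Tendsto (fun S : Finset (Freq d) =>
      ∫ b, Complex.exp (Complex.I * ((∑ z ∈ S, w z * b z).re : ℂ)) ∂ν) atTop
      (𝓝 (∫ b, Complex.exp (Complex.I * ((toDistribution p b).pair f : ℂ)) ∂ν)) := by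
    refine tendsto_integral_filter_of_dominated_convergence (fun _ => 1)
      (Eventually.of_forall fun S => (continuous_exp_re_sum S w).aestronglyMeasurable)
      (Eventually.of_forall fun S => ae_of_all _ fun b => (norm_exp_I_mul_ofReal _).le)
      (integrable_const _) ?_
    filter_upwards [hgood] with b hb
    obtain ⟨R, hR⟩ := id hb
    rw [pair_toDistribution hb]
    have hs : Tendsto (fun S : Finset (Freq d) => (∑ z ∈ S, w z * b z).re) atTop
        (𝓝 (∑' z, pairTerm b f z)) := by
      have hs : Tendsto (fun S : Finset (Freq d) => ∑ z ∈ S, pairTerm b f z) atTop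
        (𝓝 (∑' z, pairTerm b f z)) := (summable_pairTerm hR f).hasSum
      refine hs.congr fun S => ?_
      rw [Complex.re_sum]
      rfl
    have hc : Continuous fun r : ℝ => Complex.exp (Complex.I * (r : ℂ)) := by fun_prop
    exact (hc.tendsto _).comp hs
  have htrig : ∀ (S : Finset (Freq d)) x, trigPoly S w x = ∑ z ∈ S, (fourierTerm f x z).re := by
    intro S x
    rw [trigPoly, Complex.re_sum]
    refine Finset.sum_congr rfl fun z _ => ?_
    rw [fourierTerm_eq, hw]
    congr 1
    ring
  have h2 : Tendsto (fun S : Finset (Freq d) => ∫ x, |trigPoly S w x| ^ α) atTop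
      (𝓝 (∫ x, |potential f x| ^ α)) := by
    refine tendsto_integral_filter_of_dominated_convergence
      (fun _ => (∑' z : Freq d, ‖coef f z.1‖) ^ α)
      (Eventually.of_forall fun S => ((continuous_trigPoly S w).abs.rpow_const
        fun _ => Or.inr hα.le).aestronglyMeasurable)
      (Eventually.of_forall fun S => ae_of_all _ fun x => ?_) (integrable_const _)
      (ae_of_all _ fun x => ?_)
    · rw [Real.norm_of_nonneg (by positivity), htrig]
      refine Real.rpow_le_rpow (abs_nonneg _) ?_ hα.le
      refine (Finset.abs_sum_le_sum_abs _ _).trans ((Finset.sum_le_sum fun z _ =>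
        abs_re_fourierTerm_le f x z).trans ?_)
      exact (summable_norm_coef_subtype f).sum_le_tsum S fun z _ => norm_nonneg _
    · simp only [htrig]
      have hs : Tendsto (fun S : Finset (Freq d) => ∑ z ∈ S, (fourierTerm f x z).re) atTop
        (𝓝 (potential f x)) := hasSum_potential f x
      exact hs.abs.rpow_const (Or.inr hα.le)
  simp only [hchar] at h1
  refine tendsto_nhds_unique h1 ?_
  exact (Complex.continuous_ofReal.tendsto _).comp ((Real.continuous_exp.tendsto _).comp
      ((h2.const_mul (c ^ α)).neg))

/-- The exponent is homogeneous of degree `α` in `f`, and `a^α + b^α` is the `α`-th power of its own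
`1/α`-th power. -/
lemma isAlphaStableField_of_charFunctional {α c : ℝ} (hα : 0 < α) {Q : Measure (TorusDistribution d)}
    (hQ : ∀ f : SmoothFun d,
      charFunctional Q f = (Real.exp (-(c ^ α * ∫ x, |potential f x| ^ α)) : ℂ)) :
    IsAlphaStableField α Q := by
  intro a b ha hb f
  have key : ∀ r : ℝ, 0 < r → ∫ x, |potential (r • f) x| ^ α =
      r ^ α * ∫ x, |potential f x| ^ α := by
    intro r hr
    rw [← integral_const_mul]
    refine integral_congr_ae (ae_of_all _ fun x => ?_)
    simp only [potential_smul]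
    rw [abs_mul, abs_of_pos hr, Real.mul_rpow hr.le (abs_nonneg _)]
  have hab : 0 < a ^ α + b ^ α := by positivity
  rw [hQ, hQ, hQ, key a ha, key b hb, key _ (by positivity), ← Complex.ofReal_mul, ← Real.exp_add,
    ← Real.rpow_mul hab.le, one_div_mul_cancel hα.ne', Real.rpow_one]
  congr 2
  ring

end RandomDistribution

/-! ### Convergence in distribution -/

section Convergence

/-- The **Cramér–Wold** form of Lévy's theorem on `ℝ^m`. -/
lemma tendsto_of_tendsto_integral_exp {m : ℕ} {ν : ℕ → ProbabilityMeasure (Fin m → ℝ)}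
    {ν₀ : ProbabilityMeasure (Fin m → ℝ)}
    (h : ∀ θ : Fin m → ℝ, Tendsto
      (fun n => ∫ x, Complex.exp (Complex.I * ((∑ j, θ j * x j : ℝ) : ℂ)) ∂(ν n : Measure (Fin m → ℝ))) atTop
      (𝓝 (∫ x, Complex.exp (Complex.I * ((∑ j, θ j * x j : ℝ) : ℂ)) ∂(ν₀ : Measure (Fin m → ℝ))))) :
    Tendsto ν atTop (𝓝 ν₀) := by
  -- Characteristic functions require an inner product, so the laws are carried to `EuclideanSpace`
  -- and back by mutually inverse continuous maps.
  have hc : Continuous (WithLp.toLp 2 : (Fin m → ℝ) → EuclideanSpace ℝ (Fin m)) :=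
    PiLp.continuous_toLp 2 _
  have hc' : Continuous (WithLp.ofLp : EuclideanSpace ℝ (Fin m) → (Fin m → ℝ)) :=
    PiLp.continuous_ofLp 2 _
  have hchar : ∀ (ν : ProbabilityMeasure (Fin m → ℝ)) (t : EuclideanSpace ℝ (Fin m)),
      charFun (ν.map hc.measurable.aemeasurable : Measure (EuclideanSpace ℝ (Fin m))) t =
        ∫ x, Complex.exp (Complex.I * ((∑ j, t j * x j : ℝ) : ℂ)) ∂(ν : Measure (Fin m → ℝ)) := by
    intro ν t
    rw [charFun_apply, ProbabilityMeasure.toMeasure_map, integral_map hc.measurable.aemeasurable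
      (by fun_prop)]
    refine integral_congr_ae (ae_of_all _ fun x => ?_)
    simp only
    rw [mul_comm, EuclideanSpace.inner_eq_star_dotProduct]
    simp [dotProduct]
  have h1 : Tendsto (fun n => (ν n).map hc.measurable.aemeasurable) atTop
      (𝓝 (ν₀.map hc.measurable.aemeasurable)) := by
    rw [ProbabilityMeasure.tendsto_iff_tendsto_charFun]
    intro t
    simp only [hchar]
    exact h t
  have h2 := ProbabilityMeasure.tendsto_map_of_tendsto_of_continuous _ _ h1 hc'
  have hid : ∀ ν : ProbabilityMeasure (Fin m → ℝ),
      (ν.map hc.measurable.aemeasurable).map hc'.measurable.aemeasurable = ν := by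
    intro ν
    refine Subtype.ext ?_
    change Measure.map WithLp.ofLp (Measure.map (WithLp.toLp 2) (ν : Measure (Fin m → ℝ))) = ν.1
    rw [Measure.map_map hc'.measurable hc.measurable]
    exact Measure.map_id
  simpa only [hid] using h2

lemma tendsto_pnat_of_tendsto_succPNat {X : Type*} {u : ℕ+ → X} {l : Filter X}
    (h : Tendsto (fun m : ℕ => u m.succPNat) atTop l) : Tendsto u atTop l := by
  have := h.comp OrderIso.pnatIsoNat.tendsto_atTop
  refine this.congr fun n => ?_
  simp [Function.comp]

lemma tendsto_succPNat : Tendsto Nat.succPNat atTop atTop :=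
  OrderIso.pnatIsoNat.symm.tendsto_atTop

lemma pair_sum {d m : ℕ} (T : TorusDistribution d) (f : Fin m → SmoothFun d) (θ : Fin m → ℝ) :
    T.pair (∑ j, θ j • f j) = ∑ j, θ j * T.pair (f j) := by
  simp [TorusDistribution.pair, map_sum]

lemma fieldPair_sum {d m : ℕ} {n : ℕ+} (s : Site d n → ℝ) (f : Fin m → SmoothFun d)
    (θ : Fin m → ℝ) : fieldPair s (∑ j, θ j • f j) = ∑ j, θ j * fieldPair s (f j) := by
  simp only [fieldPair_eq_sum, Finset.mul_sum]
  rw [Finset.sum_comm]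
  refine Finset.sum_congr rfl fun y _ => ?_
  have : ∫ x in cell y, (∑ j, θ j • f j : SmoothFun d).1 x =
      ∑ j, θ j * ∫ x in cell y, (f j).1 x := by
    simp only [← integral_const_mul]
    rw [← integral_finsetSum]
    · refine integral_congr_ae (ae_of_all _ fun x => ?_)
      simp
    · exact fun j _ =>
        ((integrable_of_continuous (continuous_smoothFun (f j))).const_mul _).integrableOn
  rw [this, Finset.mul_sum]
  exact Finset.sum_congr rfl fun j _ => by ring

lemma integral_sum_smul {d m : ℕ} (f : Fin m → SmoothFun d) (hf : ∀ j, ∫ x, (f j).1 x = 0)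
    (θ : Fin m → ℝ) : ∫ x, (∑ j, θ j • f j : SmoothFun d).1 x = 0 := by
  have : ∀ x, (∑ j, θ j • f j : SmoothFun d).1 x = ∑ j, θ j * (f j).1 x := fun x => by
    simp
  simp only [this]
  rw [integral_finsetSum _ fun j _ =>
    (integrable_of_continuous (continuous_smoothFun (f j))).const_mul _]
  simp [integral_const_mul, hf]

end Convergence

end Sandpile

end

open Sandpile in
theorem mainTheorem3 (d : ℕ) (hd : 1 ≤ d) (α c : ℝ) (hα : 0 < α) (hα2 : α ≤ 2) (hc : 0 < c)
    (μ : Measure ℝ) [IsProbabilityMeasure μ]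
    (hμ : Sandpile.InDomainOfNormalAttraction α c μ)
    {Ω : ℕ+ → Type*} [∀ n, MeasurableSpace (Ω n)]
    (P : (n : ℕ+) → Measure (Ω n)) [∀ n, IsProbabilityMeasure (P n)]
    (σ : (n : ℕ+) → Sandpile.Site d n → Ω n → ℝ)
    (hσ_law : ∀ n x, HasLaw (σ n x) μ (P n))
    (hσ_indep : ∀ n, iIndepFun (σ n) (P n)) :
    (∀ n ω x, Sandpile.emitted (Sandpile.initialConfig (fun y => σ n y ω)) x ≠ ∞) ∧
    ∃ (Q : Measure (Sandpile.TorusDistribution d)) (_ : IsProbabilityMeasure Q),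
      Sandpile.IsAlphaStableField α Q ∧
      (∀ f : Sandpile.SmoothFun d,
        (∀ x, Summable (Sandpile.fourierTerm f x)) ∧
        Integrable (fun x => ‖∑' z, Sandpile.fourierTerm f x z‖ ^ α) ∧
        Sandpile.charFunctional Q f =
          (Real.exp (-(c ^ α * ∫ x, ‖∑' z, Sandpile.fourierTerm f x z‖ ^ α)) : ℂ)) ∧
      (∀ (m : ℕ) (f : Fin m → Sandpile.SmoothFun d), (∀ j, ∫ x, (f j).1 x = 0) →
        TendstoInDistribution
          (fun (n : ℕ+) (ω : Ω n) (j : Fin m) =>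
            Sandpile.scaling d α n *
              Sandpile.fieldPair (Sandpile.initialConfig (fun y => σ n y ω)) (f j))
          atTop (fun (T : Sandpile.TorusDistribution d) (j : Fin m) => T.pair (f j)) P Q) := by
  refine ⟨fun n ω x => emitted_ne_top hd _ (sum_initialConfig _) x, ?_⟩
  -- The attracting stable law `ρ` is also the building block of the noise that defines `Q`.
  obtain ⟨ρ, hρ, hstab, -⟩ := id hμ.2
  obtain ⟨Q, hQ, hchar⟩ := exists_stable_distribution hα hc hstab d
  refine ⟨Q, hQ, isAlphaStableField_of_charFunctional hα hchar, fun f => ⟨summable_fourierTerm f,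
    ?_, ?_⟩, fun m f hf => ?_⟩
  · simp only [norm_tsum_fourierTerm]
    exact integrable_of_continuous
      ((continuous_potential f).abs.rpow_const fun _ => Or.inr hα.le)
  · simp only [norm_tsum_fourierTerm]
    exact hchar f
  have hX : ∀ n : ℕ+, AEMeasurable (fun (ω : Ω n) (j : Fin m) =>
      scaling d α n * fieldPair (initialConfig (fun y => σ n y ω)) (f j)) (P n) := by
    intro n
    refine aemeasurable_pi_lambda _ fun j => ?_
    -- Measurability comes from the linear formula in `σ`, without examining the odometer as a
    -- function of the configuration.
    obtain ⟨k, hk, -⟩ := exists_weights hd hα hα2 (f j) (hf j)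
    simp only [hk]
    exact Finset.aemeasurable_fun_sum _ fun x _ => (hσ_law n x).aemeasurable.const_mul _
  have hZ : AEMeasurable (fun (T : TorusDistribution d) (j : Fin m) => T.pair (f j)) Q :=
    (measurable_pi_lambda _ fun j => measurable_pair (f j)).aemeasurable
  refine ⟨hX, hZ, tendsto_pnat_of_tendsto_succPNat (tendsto_of_tendsto_integral_exp fun θ => ?_)⟩
  have hexp : Measurable fun x : Fin m → ℝ =>
      Complex.exp (Complex.I * ((∑ j, θ j * x j : ℝ) : ℂ)) := by fun_prop
  simp only [ProbabilityMeasure.coe_mk]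
  rw [integral_map hZ hexp.aestronglyMeasurable]
  have h0 := integral_sum_smul f hf θ
  -- Both pairings are linear in the test function, so the joint characteristic function at `θ` is
  -- the one-function case for `∑ θ_j f_j`.
  obtain ⟨k, hk, hk0, hkI⟩ := exists_weights hd hα hα2 (∑ j, θ j • f j) h0
  have hlim := (tendsto_prod_charFun hα hμ hk0 hkI).comp tendsto_succPNat
  rw [← hchar, charFunctional] at hlim
  simp only [pair_sum] at hlim
  refine hlim.congr fun n => ?_
  rw [integral_map (hX _) hexp.aestronglyMeasurable, Function.comp_apply,
    ← integral_exp_of_iIndepFun (hσ_law _) (hσ_indep _)]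
  refine integral_congr_ae (ae_of_all _ fun ω => ?_)
  simp only [← hk, fieldPair_sum, Finset.mul_sum]
  congr 4
  funext j
  ring
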